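/- All problems are query (black-box) search problems. A search problem is a relation $R\subseteq\{0,1\}^n\times\mathcal O$, where $n$ is its number of input bits; a family of search problems is indexed by one or several size parameters, and is total if every input of every member has a solution. A family is in $\mathsf{TFNP}^{dt}$ if it is total and, for every output $o$, some decision tree of depth $\mathrm{poly}(\log n)$ decides whether $o$ is a solution. An $S$-formulation of $R$, for $S\subseteq\{0,1\}^m\times\mathcal O'$, consists of a decision tree $f_i$ over the input of $R$ for every $i\in[m]$ and a decision tree $g_o$ with outputs in $\mathcal O$ for every $o\in\mathcal O'$, such that $(f(x),o)\in S$ implies $(x,g_o(x))\in R$; its complexity is $\log m$ plus the maximal depth of these trees. A family $R$ reduces to a family $S$, $R\le_{dt}S$, if every member of $R$ with $n$ input bits has a formulation of complexity $\mathrm{poly}(\log n)$ by some member of $S$. The class defined by $S$ consists of the total families that reduce to $S$; a family is complete for a class if it belongs to it and every family in the class reduces to it. For two families $R,S$, an instance of $R\cap S$ is a pair of an instance of $R$ and an instance of $S$, and a solution is a solution of either one. Functions between sets $[N]=\{1,\dots,N\}$, $N\ge1$, are given by bit tables. * Lossy-Code: given $f:[N]\to[2N]$, $g:[2N]\to[N]$,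 find $x\in[2N]$ with $f(g(x))\ne x$. Bij-Lossy-Code also accepts $y\in[N]$ with $g(f(y))\ne y$. * Empty-Child-with-Height: given $F,L,R:V\to V$ and $H:V\to[|V|]$ with $V=[N]$, find $u\in V$ with $F(L(u))\ne u$, or $F(R(u))\ne u$, or $L(u)=R(u)\ne u$; or $u=1$ if $L(1)=1$ or $R(1)=1$ or $F(1)\ne1$; or $u\ne1$ with $u\ne F(u)$ and $H(u)\ne H(F(u))+1$; or $u=1$ if $H(1)\ne1$. Binary-Empty-Child-with-Height also accepts $u\ne1$ with $u\notin\{L(F(u)),R(F(u))\}$. * Sink-Of-Metered-Line: given $S,P:[N]\to[N]$ and $V:[N]\to[N]\cup\{0\}$, find $1$ if $P(1)\ne1$ or $S(1)=1$ or $V(1)\ne1$; or $x$ with $P(S(x))\ne x$; or $x\ne1$ with $V(x)=1$; or $x$ with ($V(x)>0$ and $V(S(x))-V(x)\ne1$) or ($V(x)>1$ and $V(x)-V(P(x))\ne1$). End-Of-Metered-Line also accepts $x\ne1$ with $S(P(x))\ne x$, and $x$ with $V(x)>0$ and $V(S(x))-V(x)\ne1$. * $\mathsf{Lossy}$ is the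 class defined by Lossy-Code. $\mathsf{PLS}$ is the class defined by Sink-Of-DAG (given $S,V:[N]\to[N]$, find $1$ if $S(1)=1$; or $x$ with $S(x)\ne x$ and either $S(S(x))=S(x)$ or $V(S(x))\le V(x)$). $\mathsf{PPADS}$ is the class defined by Sink-Of-Line (given $S,P:[N]\to[N]$, find $1$ if $P(1)\ne1$ or $S(1)=1$; or $x$ with $P(S(x))\ne x$). $\mathsf{SOPL}$ is the class defined by Sink-Of-Potential-Line (given $S,P:[N]\to[N]$ and $V:[N]\to\{0,\dots,N-1\}$, find $1$ if $P(1)\ne1$ or $S(1)=1$ or $V(1)\ne0$; or $x$ with $P(S(x))\ne x$; or $x$ with $S(x)\ne x$, $P(S(x))=x$ and $V(S(x))\le V(x)$). Theorem. Empty-Child-with-Height is in $\mathsf{TFNP}^{dt}$ and is complete for $\mathsf{SOPL}\cap\mathsf{Lossy}$. Moreover: (1) Lossy-Code $\cap$ Sink-Of-Metered-Line reduces to Empty-Child-with-Height; (2) Empty-Child-with-Height is in $\mathsf{PLS}$ and in $\mathsf{Lossy}$, and it is in $\mathsf{SOPL}$, where $\mathsf{SOPL}=\mathsf{PLS}\cap\mathsf{PPADS}$;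 (3) Bij-Lossy-Code $\cap$ End-Of-Metered-Line reduces to Binary-Empty-Child-with-Height. -/

import Mathlib

namespace BlackBox

/-! ### Decision trees and query search problems -/

/-- Decision trees that query Boolean variables indexed by `X`; leaves are labelled by `α`.
At a node the tree queries a variable and continues left on `false`, right on `true`. -/
inductive DecisionTree (X α : Type) : Type where
  | leaf (a : α) : DecisionTree X α
  | query (i : X) (t₀ t₁ : DecisionTree X α) : DecisionTree X α

namespace DecisionTree

/-- The label of the leaf reached on input `x`. -/
def eval {X α : Type} (x : X → Bool) : DecisionTree X α → α
  | leaf a => a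
  | query i t₀ t₁ => if x i then eval x t₁ else eval x t₀

/-- The largest number of queries on a root-to-leaf path. -/
def depth {X α : Type} : DecisionTree X α → ℕ
  | leaf _ => 0
  | query _ t₀ t₁ => max (depth t₀) (depth t₁) + 1

end DecisionTree

/-- A single query search problem: a relation between Boolean inputs, whose bits are indexed by
the finite type `Var`, and outputs in `Out`. -/
structure SearchProblem where
  Var : Type
  [fintypeVar : Fintype Var]
  Out : Type
  Sol : (Var → Bool) → Out → Prop

attribute [instance] SearchProblem.fintypeVar

/-- The number of input bits. -/
def SearchProblem.size (R : SearchProblem) : ℕ := Fintype.card R.Var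

/-- A family of query search problems. The members are indexed by an arbitrary type of
parameters, so that sequences `(Rₙ)` and families with several size parameters are covered. -/
structure SearchFamily where
  Idx : Type
  prob : Idx → SearchProblem

/-- Every input of every member has a solution. -/
def IsTotal (R : SearchFamily) : Prop :=
  ∀ (i : R.Idx) (x : (R.prob i).Var → Bool), ∃ o, (R.prob i).Sol x o

/-- The polylogarithmic bound `C * (log n) ^ k + C`. -/
def polylog (C k n : ℕ) : ℕ := C * (Nat.log 2 n) ^ k + C

/-- Total search problems whose solutions are verified by decision trees of polylogarithmic
depth. -/
def TFNPdt : Set SearchFamily :=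
  {R | IsTotal R ∧ ∃ C k : ℕ, ∀ (i : R.Idx) (o : (R.prob i).Out),
    ∃ T : DecisionTree (R.prob i).Var Bool,
      T.depth ≤ polylog C k (R.prob i).size ∧
      ∀ x, T.eval x = true ↔ (R.prob i).Sol x o}

/-! ### Decision tree reductions -/

/-- An `S`-formulation of `R`: a decision tree for each input bit of `S`, and for each output `o`
of `S` a decision tree computing an output of `R`. -/
structure Formulation (R S : SearchProblem) where
  inp : S.Var → DecisionTree R.Var Bool
  out : S.Out → DecisionTree R.Var R.Out
  correct : ∀ (x : R.Var → Bool) (o : S.Out),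
    S.Sol (fun i => (inp i).eval x) o → R.Sol x ((out o).eval x)

/-- The formulation has complexity (logarithm of its size plus its depth) at most `c`. -/
def Formulation.ComplexityLE {R S : SearchProblem} (φ : Formulation R S) (c : ℕ) : Prop :=
  ∃ d : ℕ, (∀ i, (φ.inp i).depth ≤ d) ∧ (∀ o, (φ.out o).depth ≤ d) ∧ Nat.log 2 S.size + d ≤ c

/-- Efficient decision tree reducibility: each member of `R` with `n` input bits has a
formulation of complexity `poly(log n)` by some member of `S`. -/
def Reduces (R S : SearchFamily) : Prop :=
  ∃ C k : ℕ, ∀ i : R.Idx, ∃ (j : S.Idx) (φ : Formulation (R.prob i) (S.prob j)),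
    φ.ComplexityLE (polylog C k (R.prob i).size)

infix:50 " ≤dt " => Reduces

/-- The class of total search problems that are efficiently reducible to `S`. -/
def classOf (S : SearchFamily) : Set SearchFamily := {R | IsTotal R ∧ R ≤dt S}

/-- `R` belongs to the class `𝒞`, and every problem of `𝒞` reduces to `R`. -/
def IsCompleteFor (R : SearchFamily) (𝒞 : Set SearchFamily) : Prop :=
  R ∈ 𝒞 ∧ ∀ Q ∈ 𝒞, Q ≤dt R

/-- The intersection problem: the input consists of an instance of `R` and an instance of `S`
(with independent parameters), and a solution of either one is a solution. -/
def SearchFamily.inter (R S : SearchFamily) : SearchFamily where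
  Idx := R.Idx × S.Idx
  prob p :=
    { Var := (R.prob p.1).Var ⊕ (S.prob p.2).Var
      Out := (R.prob p.1).Out ⊕ (S.prob p.2).Out
      Sol := fun x o => match o with
        | Sum.inl a => (R.prob p.1).Sol (fun i => x (Sum.inl i)) a
        | Sum.inr b => (S.prob p.2).Sol (fun i => x (Sum.inr i)) b }

/-! ### Functions as bit strings

The set `[N]` is represented by `Fin N`; the distinguished element `1` of `[N]` is `0 : Fin N`. -/

/-- Bit positions of the table of a function `[A] → [B]`: `⌈log₂ B⌉` bits for each argument. -/
abbrev TableVar (A B : ℕ) : Type := Fin A × Fin (Nat.clog 2 B)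

/-- The function `[A] → [B]` given by a table. A value is read in binary, modulo `B`, so that
every bit string is the table of a function (and every function has a table). -/
def readTable {A B : ℕ} [NeZero B] (x : TableVar A B → Bool) (a : Fin A) : Fin B :=
  Fin.ofNat B (Nat.ofBits fun k => x (a, k))

/-! ### Lossy-Code and its bijective version -/

/-- `Lossy-Code`: for `f : [N] → [2N]` and `g : [2N] → [N]`, find `x ∈ [2N]` with
`f (g x) ≠ x`. -/
def LossyCode : SearchFamily where
  Idx := ℕ+
  prob N :=
    { Var := TableVar N (2 * N : ℕ+) ⊕ TableVar (2 * N : ℕ+) N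
      Out := Fin (2 * N : ℕ+)
      Sol := fun z x =>
        let f : Fin N → Fin (2 * N : ℕ+) := readTable fun i => z (Sum.inl i)
        let g : Fin (2 * N : ℕ+) → Fin N := readTable fun i => z (Sum.inr i)
        f (g x) ≠ x }

/-- `Bij-Lossy-Code`: for `f : [N] → [2N]` and `g : [2N] → [N]`, find `x ∈ [2N]` with
`f (g x) ≠ x` or `y ∈ [N]` with `g (f y) ≠ y`. -/
def BijLossyCode : SearchFamily where
  Idx := ℕ+
  prob N :=
    { Var := TableVar N (2 * N : ℕ+) ⊕ TableVar (2 * N : ℕ+) N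
      Out := Fin (2 * N : ℕ+) ⊕ Fin N
      Sol := fun z o =>
        let f : Fin N → Fin (2 * N : ℕ+) := readTable fun i => z (Sum.inl i)
        let g : Fin (2 * N : ℕ+) → Fin N := readTable fun i => z (Sum.inr i)
        match o with
        | Sum.inl x => f (g x) ≠ x
        | Sum.inr y => g (f y) ≠ y }

/-! ### Empty-Child with heights -/

section EmptyChild

variable {N : ℕ} [NeZero N]

/-- (Empty Child) -/
def EmptyChildAt (F L R : Fin N → Fin N) (u : Fin N) : Prop :=
  F (L u) ≠ u ∨ F (R u) ≠ u ∨ (L u = R u ∧ R u ≠ u)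

/-- (Wrong Root) -/
def WrongRootAt (F L R : Fin N → Fin N) (u : Fin N) : Prop :=
  u = 0 ∧ (L 0 = 0 ∨ R 0 = 0 ∨ F 0 ≠ 0)

/-- (Wrong Father) -/
def WrongFatherAt (F L R : Fin N → Fin N) (u : Fin N) : Prop :=
  u ≠ 0 ∧ u ≠ L (F u) ∧ u ≠ R (F u)

/-- (Wrong Height) -/
def WrongHeightAt (F : Fin N → Fin N) (H : Fin N → ℕ) (u : Fin N) : Prop :=
  (u ≠ 0 ∧ u ≠ F u ∧ H u ≠ H (F u) + 1) ∨ (u = 0 ∧ H 0 ≠ 1)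

end EmptyChild

/-- Input bits for `F, L, R : V → V` and `H : V → [|V|]`, where `|V| = N`. -/
abbrev ECwHVar (N : ℕ) : Type :=
  (TableVar N N ⊕ TableVar N N) ⊕ (TableVar N N ⊕ TableVar N N)

/-- `Empty-Child-with-Height`. The heights `1, …, |V|` are one plus the entries of the table. -/
def EmptyChildHeight : SearchFamily where
  Idx := ℕ+
  prob N :=
    { Var := ECwHVar N
      Out := Fin N
      Sol := fun z u =>
        let F : Fin N → Fin N := readTable fun i => z (Sum.inl (Sum.inl i))
        let L : Fin N → Fin N := readTable fun i => z (Sum.inl (Sum.inr i))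
        let R : Fin N → Fin N := readTable fun i => z (Sum.inr (Sum.inl i))
        let h : Fin N → Fin N := readTable fun i => z (Sum.inr (Sum.inr i))
        let H : Fin N → ℕ := fun v => (h v : ℕ) + 1
        EmptyChildAt F L R u ∨ WrongRootAt F L R u ∨ WrongHeightAt F H u }

/-- `Binary-Empty-Child-with-Height`: additionally a wrong father is a solution. -/
def BinaryEmptyChildHeight : SearchFamily where
  Idx := ℕ+
  prob N :=
    { Var := ECwHVar N
      Out := Fin N
      Sol := fun z u =>
        let F : Fin N → Fin N := readTable fun i => z (Sum.inl (Sum.inl i))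
        let L : Fin N → Fin N := readTable fun i => z (Sum.inl (Sum.inr i))
        let R : Fin N → Fin N := readTable fun i => z (Sum.inr (Sum.inl i))
        let h : Fin N → Fin N := readTable fun i => z (Sum.inr (Sum.inr i))
        let H : Fin N → ℕ := fun v => (h v : ℕ) + 1
        EmptyChildAt F L R u ∨ WrongRootAt F L R u ∨ WrongFatherAt F L R u ∨
          WrongHeightAt F H u }

/-! ### Metered lines -/

section MeteredLine

variable {N : ℕ} [NeZero N]

/-- The solutions of `Sink-Of-Metered-Line`: (Bad Source), (Sink of Line), (Bad Meter I),
(Bad Meter II). -/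
def SinkOfMeteredLineSol (S P : Fin N → Fin N) (V : Fin N → ℕ) (x : Fin N) : Prop :=
  (x = 0 ∧ (P 0 ≠ 0 ∨ S 0 = 0 ∨ V 0 ≠ 1)) ∨
  P (S x) ≠ x ∨
  (x ≠ 0 ∧ V x = 1) ∨
  ((0 < V x ∧ V (S x) ≠ V x + 1) ∨ (1 < V x ∧ V x ≠ V (P x) + 1))

/-- The solutions of `End-Of-Metered-Line`: additionally (End of Line) and (Bad Meter III). -/
def EndOfMeteredLineSol (S P : Fin N → Fin N) (V : Fin N → ℕ) (x : Fin N) : Prop :=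
  SinkOfMeteredLineSol S P V x ∨
  (x ≠ 0 ∧ S (P x) ≠ x) ∨
  (0 < V x ∧ V (S x) ≠ V x + 1)

end MeteredLine

/-- Input bits for `S, P : [N] → [N]` and `V : [N] → [N] ∪ {0}`. -/
abbrev MeteredLineVar (N : ℕ) : Type :=
  TableVar N N ⊕ TableVar N N ⊕ TableVar N (N + 1)

/-- `Sink-Of-Metered-Line`. -/
def SinkOfMeteredLine : SearchFamily where
  Idx := ℕ+
  prob N :=
    { Var := MeteredLineVar N
      Out := Fin N
      Sol := fun z x =>
        let S : Fin N → Fin N := readTable fun i => z (Sum.inl i)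
        let P : Fin N → Fin N := readTable fun i => z (Sum.inr (Sum.inl i))
        let V : Fin N → Fin (N + 1) := readTable fun i => z (Sum.inr (Sum.inr i))
        SinkOfMeteredLineSol S P (fun v => (V v : ℕ)) x }

/-- `End-Of-Metered-Line`. -/
def EndOfMeteredLine : SearchFamily where
  Idx := ℕ+
  prob N :=
    { Var := MeteredLineVar N
      Out := Fin N
      Sol := fun z x =>
        let S : Fin N → Fin N := readTable fun i => z (Sum.inl i)
        let P : Fin N → Fin N := readTable fun i => z (Sum.inr (Sum.inl i))
        let V : Fin N → Fin (N + 1) := readTable fun i => z (Sum.inr (Sum.inr i))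
        EndOfMeteredLineSol S P (fun v => (V v : ℕ)) x }

/-! ### The defining problems of PLS, PPADS and SOPL -/

/-- `Sink-Of-DAG`: for a successor function `S : [N] → [N]` and a potential `V : [N] → [N]`, find
the source `1` if `S 1 = 1`, or a node `x ≠ S x` whose successor is a sink or does not increase
the potential. (Self-loops are isolated nodes or sinks.) -/
def SinkOfDAG : SearchFamily where
  Idx := ℕ+
  prob N :=
    { Var := TableVar N N ⊕ TableVar N N
      Out := Fin N
      Sol := fun z x =>
        let S : Fin N → Fin N := readTable fun i => z (Sum.inl i)
        let V : Fin N → Fin N := readTable fun i => z (Sum.inr i)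
        (x = 0 ∧ S 0 = 0) ∨ (S x ≠ x ∧ S (S x) = S x) ∨ (S x ≠ x ∧ V (S x) ≤ V x) }

/-- `Sink-Of-Line`: for `S, P : [N] → [N]`, find `1` if it is not a source with a successor, or a
node `x` with `P (S x) ≠ x`. -/
def SinkOfLine : SearchFamily where
  Idx := ℕ+
  prob N :=
    { Var := TableVar N N ⊕ TableVar N N
      Out := Fin N
      Sol := fun z x =>
        let S : Fin N → Fin N := readTable fun i => z (Sum.inl i)
        let P : Fin N → Fin N := readTable fun i => z (Sum.inr i)
        (x = 0 ∧ (P 0 ≠ 0 ∨ S 0 = 0)) ∨ P (S x) ≠ x }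

/-- `Sink-Of-Potential-Line`: for `S, P : [N] → [N]` and a potential `V : [N] → {0, …, N - 1}`,
find `1` if it is not a source with a successor and with potential `0`, or a node `x` with
`P (S x) ≠ x`, or an edge from `x` along which the potential does not increase. -/
def SinkOfPotentialLine : SearchFamily where
  Idx := ℕ+
  prob N :=
    { Var := TableVar N N ⊕ TableVar N N ⊕ TableVar N N
      Out := Fin N
      Sol := fun z x =>
        let S : Fin N → Fin N := readTable fun i => z (Sum.inl i)
        let P : Fin N → Fin N := readTable fun i => z (Sum.inr (Sum.inl i))
        let V : Fin N → Fin N := readTable fun i => z (Sum.inr (Sum.inr i))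
        (x = 0 ∧ (P 0 ≠ 0 ∨ S 0 = 0 ∨ V 0 ≠ 0)) ∨
          P (S x) ≠ x ∨
          (S x ≠ x ∧ P (S x) = x ∧ V (S x) ≤ V x) }

/-! ### Classes -/

def Lossy : Set SearchFamily := classOf LossyCode
def PLS : Set SearchFamily := classOf SinkOfDAG
def PPADS : Set SearchFamily := classOf SinkOfLine
def SOPL : Set SearchFamily := classOf SinkOfPotentialLine

end BlackBox

open BlackBox

/-! Membership. In an empty-child instance, following only left children gives a line with successor
`L`, predecessor `F` and the heights as potential. A sink of this line is an empty child, and a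
non-increasing edge is a wrong height or a wrong root. This gives `SOPL`, hence `PLS` and totality.
For `Lossy`, unfold the tree to depth `⌈log₂ N⌉ + 1`: there are at least `2N` paths from the root
but only `N` nodes. Walking down compresses a path to its endpoint, and climbing by `F` decompresses
it. The round trip is the identity unless some node on the path is an empty child or a wrong root,
and the path is short enough to be searched.

Hardness. A problem in `SOPL ∩ Lossy` reduces to `LossyCode` and, once the edges of the potential
line are subdivided so that the potential grows by exactly one, to `SinkOfMeteredLine`. It therefore
reduces to their intersection by running both formulations on the same input. It remains to hide a
tree in a lossy code and a metered line (`tree_solution`). Each vertex of the line carries one layer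
of nodes, layer `k + 1` lying on the successor of the vertex that carries layer `k`. The children of
a layer would double its size, but applying `g : [2N] → [N]` to the last `2N` of them, twice, brings
every layer back below `2N` nodes; `f` undoes the compression and so finds fathers. A defect of the
tree is then a defect of the line, or an argument `w` of `g` with `f (g w) ≠ w`. If moreover `g`
inverts `f` and `S` inverts `P`, every node other than the root is a child of its father
(`tree_wrongFather`), which is the binary version.

The equality `SOPL = PLS ∩ PPADS` rests on `block_solution`: inside each node of a DAG many copies
of a line run in parallel, and each copy of the free source of the line receives one of the lines
that arrive along edges of the DAG. -/

namespace BlackBox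

/-! ### Functions computed by shallow decision trees -/

namespace DecisionTree

/-- Substitute a decision tree for every leaf. -/
def bind {X α β : Type} : DecisionTree X α → (α → DecisionTree X β) → DecisionTree X β
  | leaf a, k => k a
  | query i t₀ t₁, k => query i (bind t₀ k) (bind t₁ k)

theorem eval_bind {X α β : Type} (x : X → Bool) (t : DecisionTree X α)
    (k : α → DecisionTree X β) : (t.bind k).eval x = (k (t.eval x)).eval x := by
  induction t with
  | leaf a => rfl
  | query i t₀ t₁ h₀ h₁ =>
    simp only [bind, eval]
    split <;> assumption

theorem depth_bind_le {X α β : Type} (t : DecisionTree X α) (k : α → DecisionTree X β) {d : ℕ}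
    (h : ∀ a, (k a).depth ≤ d) : (t.bind k).depth ≤ t.depth + d := by
  induction t with
  | leaf a => simpa [bind, depth] using h a
  | query i t₀ t₁ h₀ h₁ =>
    simp only [bind, depth]
    omega

end DecisionTree

/-- `g` is computed by a decision tree of depth at most `d`. -/
def Comp {X α : Type} (d : ℕ) (g : (X → Bool) → α) : Prop :=
  ∃ T : DecisionTree X α, T.depth ≤ d ∧ ∀ x, T.eval x = g x

namespace Comp

variable {X Y α β γ δ : Type} {a b c d : ℕ}

theorem mono {g : (X → Bool) → α} (hg : Comp a g) (h : a ≤ b) : Comp b g :=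
  let ⟨T, hT, hx⟩ := hg
  ⟨T, hT.trans h, hx⟩

theorem const (y : α) : Comp 0 (fun _ : X → Bool => y) :=
  ⟨.leaf y, le_rfl, fun _ => rfl⟩

theorem bit (i : X) : Comp 1 (fun x : X → Bool => x i) :=
  ⟨.query i (.leaf false) (.leaf true), by simp [DecisionTree.depth], fun x => by
    cases h : x i <;> simp [DecisionTree.eval, h]⟩

theorem bind {g : (X → Bool) → α} {h : α → (X → Bool) → β} (hg : Comp a g)
    (hh : ∀ y, Comp b (h y)) : Comp (a + b) (fun x => h (g x) x) := by
  obtain ⟨T, hT, hx⟩ := hg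
  choose U hU hy using hh
  refine ⟨T.bind U, (T.depth_bind_le U hU).trans (by omega), fun x => ?_⟩
  rw [DecisionTree.eval_bind, hx, hy]

theorem map (φ : α → β) {g : (X → Bool) → α} (hg : Comp a g) : Comp a (fun x => φ (g x)) :=
  hg.bind (h := fun y _ => φ y) fun y => const (φ y)

theorem map₂ (φ : α → β → γ) {g : (X → Bool) → α} {h : (X → Bool) → β} (hg : Comp a g)
    (hh : Comp b h) : Comp (a + b) (fun x => φ (g x) (h x)) :=
  hg.bind (h := fun y x => φ y (h x)) fun y => hh.map (φ y)

theorem eq {g h : (X → Bool) → α} (hg : Comp a g) (hh : Comp b h) :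
    Comp (a + b) (fun x => g x = h x) := map₂ _ hg hh

theorem not {g : (X → Bool) → Prop} (hg : Comp a g) : Comp a (fun x => ¬ g x) := map Not hg

theorem ne {g h : (X → Bool) → α} (hg : Comp a g) (hh : Comp b h) :
    Comp (a + b) (fun x => g x ≠ h x) := map₂ _ hg hh

theorem and {g h : (X → Bool) → Prop} (hg : Comp a g) (hh : Comp b h) :
    Comp (a + b) (fun x => g x ∧ h x) := map₂ _ hg hh

theorem or {g h : (X → Bool) → Prop} (hg : Comp a g) (hh : Comp b h) :
    Comp (a + b) (fun x => g x ∨ h x) := map₂ _ hg hh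

theorem imp {g h : (X → Bool) → Prop} (hg : Comp a g) (hh : Comp b h) :
    Comp (a + b) (fun x => g x → h x) := map₂ (fun p q => p → q) hg hh

theorem le {g h : (X → Bool) → ℕ} (hg : Comp a g) (hh : Comp b h) :
    Comp (a + b) (fun x => g x ≤ h x) := map₂ _ hg hh

theorem lt {g h : (X → Bool) → ℕ} (hg : Comp a g) (hh : Comp b h) :
    Comp (a + b) (fun x => g x < h x) := map₂ _ hg hh

theorem fin_le {n : ℕ} {g h : (X → Bool) → Fin n} (hg : Comp a g) (hh : Comp b h) :
    Comp (a + b) (fun x => g x ≤ h x) := map₂ _ hg hh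

theorem add {g h : (X → Bool) → ℕ} (hg : Comp a g) (hh : Comp b h) :
    Comp (a + b) (fun x => g x + h x) := map₂ _ hg hh

theorem val {n : ℕ} {g : (X → Bool) → Fin n} (hg : Comp a g) :
    Comp a (fun x => (g x : ℕ)) := map _ hg

theorem fin_mk {n : ℕ} [NeZero n] {g : (X → Bool) → ℕ} (hg : Comp a g) (h : ∀ x, g x < n) :
    Comp a (fun x => (⟨g x, h x⟩ : Fin n)) := by
  convert hg.map (Fin.ofNat n) using 3
  simp [Fin.ofNat, Nat.mod_eq_of_lt, h]

theorem pair {g : (X → Bool) → α} {h : (X → Bool) → β} (hg : Comp a g) (hh : Comp b h) :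
    Comp (a + b) (fun x => (g x, h x)) := map₂ _ hg hh

theorem ite {p : (X → Bool) → Prop} {_ : ∀ x, Decidable (p x)} {g h : (X → Bool) → α}
    (hp : Comp a p) (hg : Comp b g) (hh : Comp c h) :
    Comp (a + max b c) (fun x => if p x then g x else h x) := by
  classical
  have := hp.bind (h := fun y x => if y then g x else h x) (b := max b c) fun y => by
    by_cases hy : y
    · simpa [hy] using hg.mono (le_max_left b c)
    · simpa [hy] using hh.mono (le_max_right b c)
  convert this using 4

/-- Substitution of computed bits for queries. -/
theorem subst {g : (Y → Bool) → α} {h : (X → Bool) → Y → Bool} (hg : Comp a g)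
    (hh : ∀ i, Comp b fun x => h x i) : Comp (a * b) (fun x => g (h x)) := by
  obtain ⟨T, hT, hg⟩ := hg
  have key : Comp (T.depth * b) (fun x => T.eval (h x)) := by
    clear hT hg
    induction T with
    | leaf y => simpa [DecisionTree.depth, DecisionTree.eval] using Comp.const y
    | query i t₀ t₁ h₀ h₁ =>
      have : Comp _ fun x => if h x i = true then t₁.eval (h x) else t₀.eval (h x) :=
        ((hh i).eq (Comp.const true)).ite h₁ h₀
      refine this.mono ?_
      simp only [DecisionTree.depth, add_mul, ← max_mul, max_comm]
      omega
  simp only [hg] at key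
  exact key.mono (Nat.mul_le_mul_right _ hT)

theorem bits {n : ℕ} (p : Fin n → X) : Comp n (fun x : X → Bool => fun k => x (p k)) := by
  induction n with
  | zero => convert Comp.const (X := X) (Fin.elim0 : Fin 0 → Bool) using 2
  | succ n ih =>
    have := (bit (p 0)).map₂ (fun y (v : Fin n → Bool) => (Fin.cons y v : Fin (n + 1) → Bool))
      (ih fun k => p k.succ)
    have h := this.mono (b := n + 1) (by omega)
    convert h using 2 with x
    funext k
    refine Fin.cases ?_ (fun k => ?_) k <;> simp

/-- Reading an entry of a table at a computed position. -/
theorem read {A B : ℕ} [NeZero B] {ι : TableVar A B → X} {g : (X → Bool) → Fin A}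
    (hg : Comp a g) :
    Comp (a + Nat.clog 2 B) (fun x => readTable (fun i => x (ι i)) (g x)) :=
  hg.bind (h := fun y x => readTable (fun i => x (ι i)) y) fun y =>
    (bits fun k => ι (y, k)).map fun v => Fin.ofNat B (Nat.ofBits v)

theorem reindex {g : (Y → Bool) → α} (ι : Y → X) (hg : Comp a g) :
    Comp a (fun x => g fun i => x (ι i)) := by
  simpa using hg.subst (h := fun x i => x (ι i)) fun i => bit (ι i)

end Comp

/-! ### Tables -/

/-- The table of a function. -/
def writeTable {A B : ℕ} (φ : Fin A → Fin B) : TableVar A B → Bool :=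
  fun i => (φ i.1 : ℕ).testBit i.2

@[simp] theorem readTable_writeTable {A B : ℕ} [NeZero B] (φ : Fin A → Fin B) :
    readTable (writeTable φ) = φ := by
  funext a
  have h : (φ a : ℕ) < 2 ^ Nat.clog 2 B := (φ a).2.trans_le (Nat.le_pow_clog one_lt_two B)
  apply Fin.ext
  simp [readTable, writeTable, Nat.ofBits_testBit, Nat.mod_eq_of_lt h]

theorem Comp.writeTable {X : Type} {A B d : ℕ} {φ : (X → Bool) → Fin A → Fin B}
    (h : ∀ a, Comp d fun x => φ x a) (i : TableVar A B) :
    Comp d fun x => BlackBox.writeTable (φ x) i :=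
  (h i.1).map fun v : Fin B => (v : ℕ).testBit i.2

/-! ### Reductions presented by functions -/

/-- A decision tree of depth at most `d` finds a solution on every input with the property `p`. -/
def Solves (d : ℕ) (R : SearchProblem) (p : (R.Var → Bool) → Prop) : Prop :=
  ∃ G : (R.Var → Bool) → R.Out, Comp d G ∧ ∀ x, p x → R.Sol x (G x)

/-- An `S`-formulation of `R` of depth at most `d`, presented by the functions that the decision
trees compute. -/
def Red (d : ℕ) (R S : SearchProblem) : Prop :=
  ∃ F : (R.Var → Bool) → S.Var → Bool, (∀ i, Comp d fun x => F x i) ∧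
    ∀ o : S.Out, Solves d R fun x => S.Sol (F x) o

theorem Red.mono {R S : SearchProblem} {d e : ℕ} (h : Red d R S) (hde : d ≤ e) : Red e R S := by
  obtain ⟨F, hF, hG⟩ := h
  refine ⟨F, fun i => (hF i).mono hde, fun o => ?_⟩
  obtain ⟨G, hG, h⟩ := hG o
  exact ⟨G, hG.mono hde, h⟩

theorem Red.exists_formulation {R S : SearchProblem} {d c : ℕ} (h : Red d R S)
    (hc : Nat.log 2 S.size + d ≤ c) : ∃ φ : Formulation R S, φ.ComplexityLE c := by
  obtain ⟨F, hF, hG⟩ := h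
  choose inp hinp hF using hF
  choose G hG hsol using hG
  choose out hout hG using hG
  refine ⟨⟨inp, out, fun x o h => ?_⟩, d, hinp, hout, hc⟩
  simp only [hF] at h
  rw [hG]
  exact hsol o x h

theorem Formulation.ComplexityLE.red {R S : SearchProblem} {φ : Formulation R S} {c : ℕ}
    (h : φ.ComplexityLE c) : ∃ d, Red d R S ∧ Nat.log 2 S.size + d ≤ c := by
  obtain ⟨d, hi, ho, hc⟩ := h
  exact ⟨d, ⟨fun x i => (φ.inp i).eval x, fun i => ⟨φ.inp i, hi i, fun _ => rfl⟩,
    fun o => ⟨_, ⟨φ.out o, ho o, fun _ => rfl⟩, fun x => φ.correct x o⟩⟩, hc⟩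

theorem Red.trans {R S T : SearchProblem} {d e : ℕ} (h₁ : Red d R S) (h₂ : Red e S T) :
    Red (e * d + d) R T := by
  obtain ⟨F₁, hF₁, hG₁⟩ := h₁
  obtain ⟨F₂, hF₂, hG₂⟩ := h₂
  refine ⟨fun x => F₂ (F₁ x), fun i => ((hF₂ i).subst hF₁).mono (by omega), fun o => ?_⟩
  obtain ⟨G₂, hG₂, h₂⟩ := hG₂ o
  choose G₁ hG₁ h₁ using hG₁
  exact ⟨fun x => G₁ (G₂ (F₁ x)) x, (hG₂.subst hF₁).bind hG₁, fun x hx => h₁ _ x (h₂ _ hx)⟩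

/-! ### Polylogarithmic bounds -/

theorem polylog_le (C k n : ℕ) : polylog C k n ≤ 2 * C * (Nat.log 2 n + 1) ^ k := by
  have h₁ : Nat.log 2 n ^ k ≤ (Nat.log 2 n + 1) ^ k := Nat.pow_le_pow_left (by omega) k
  have h₂ : 1 ≤ (Nat.log 2 n + 1) ^ k := Nat.one_le_pow _ _ (by omega)
  have := Nat.mul_le_mul_left C h₁
  have := Nat.mul_le_mul_left C h₂
  unfold polylog
  linarith

theorem le_polylog (c k n : ℕ) : c * (Nat.log 2 n + 1) ^ k ≤ polylog (c * 2 ^ k) k n := by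
  unfold polylog
  generalize Nat.log 2 n = l
  have : (l + 1) ^ k ≤ 2 ^ k * (l ^ k + 1) := by
    rcases Nat.eq_zero_or_pos l with rfl | hl
    · calc (0 + 1) ^ k = 1 := by simp
        _ ≤ 2 ^ k * (0 ^ k + 1) := Nat.mul_pos (by positivity) (Nat.succ_pos _)
    · calc (l + 1) ^ k ≤ (2 * l) ^ k := Nat.pow_le_pow_left (by omega) k
        _ = 2 ^ k * l ^ k := mul_pow ..
        _ ≤ _ := Nat.mul_le_mul_left _ (by omega)
  calc c * (l + 1) ^ k ≤ c * (2 ^ k * (l ^ k + 1)) := Nat.mul_le_mul_left _ this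
    _ = _ := by ring

/-- The form `c * (log n + 1) ^ k` is monotone in `k` and closed under products and composition,
which `polylog` is only up to constants. -/
theorem reduces_iff {R S : SearchFamily} : R ≤dt S ↔ ∃ c k : ℕ, ∀ i, ∃ j d,
    Red d (R.prob i) (S.prob j) ∧
      Nat.log 2 (S.prob j).size + d ≤ c * (Nat.log 2 (R.prob i).size + 1) ^ k := by
  constructor
  · rintro ⟨C, k, h⟩
    refine ⟨2 * C, k, fun i => ?_⟩
    obtain ⟨j, φ, hφ⟩ := h i
    obtain ⟨d, hd, hc⟩ := hφ.red
    exact ⟨j, d, hd, hc.trans (polylog_le ..)⟩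
  · rintro ⟨c, k, h⟩
    refine ⟨c * 2 ^ k, k, fun i => ?_⟩
    obtain ⟨j, d, hd, hc⟩ := h i
    obtain ⟨φ, hφ⟩ := hd.exists_formulation (hc.trans (le_polylog ..))
    exact ⟨j, φ, hφ⟩

/-- The complexity of a formulation includes the logarithm of the size of its target, so what is
polylogarithmic for the middle problem is polylogarithmic for the first one. -/
theorem Reduces.trans {R S T : SearchFamily} (h₁ : R ≤dt S) (h₂ : S ≤dt T) : R ≤dt T := by
  rw [reduces_iff] at *
  obtain ⟨c₁, k₁, h₁⟩ := h₁
  obtain ⟨c₂, k₂, h₂⟩ := h₂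
  refine ⟨(c₂ * (c₁ + 1) ^ k₂) + (c₂ * (c₁ + 1) ^ k₂) * c₁ + c₁, k₁ * k₂ + k₁, fun i => ?_⟩
  obtain ⟨j, d, hd, hc⟩ := h₁ i
  obtain ⟨l, e, he, hc'⟩ := h₂ j
  refine ⟨l, e * d + d, hd.trans he, ?_⟩
  set m := Nat.log 2 (R.prob i).size + 1
  have hm : ∀ k, 1 ≤ m ^ k := fun k => Nat.one_le_pow _ _ (by omega)
  have hS : (Nat.log 2 (S.prob j).size + 1) ^ k₂ ≤ (c₁ + 1) ^ k₂ * m ^ (k₁ * k₂) := by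
    rw [pow_mul, ← mul_pow]
    refine Nat.pow_le_pow_left ?_ k₂
    have := hm k₁
    rw [add_mul]
    omega
  have h₃ : Nat.log 2 (T.prob l).size + e ≤ c₂ * (c₁ + 1) ^ k₂ * m ^ (k₁ * k₂) :=
    hc'.trans (by rw [mul_assoc]; exact Nat.mul_le_mul_left _ hS)
  have hd' : d ≤ c₁ * m ^ k₁ := by omega
  generalize c₂ * (c₁ + 1) ^ k₂ = c at *
  have h₄ : e * d ≤ (c * m ^ (k₁ * k₂)) * (c₁ * m ^ k₁) := Nat.mul_le_mul (by omega) hd'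
  have h₅ : c * m ^ (k₁ * k₂) ≤ c * m ^ (k₁ * k₂) * m ^ k₁ := Nat.le_mul_of_pos_right _ (hm _)
  have h₆ : c₁ * m ^ k₁ ≤ c₁ * m ^ k₁ * m ^ (k₁ * k₂) := Nat.le_mul_of_pos_right _ (hm _)
  rw [pow_add]
  nlinarith

theorem IsTotal.of_reduces {R S : SearchFamily} (hS : IsTotal S) (h : R ≤dt S) : IsTotal R := by
  obtain ⟨C, k, h⟩ := h
  intro i x
  obtain ⟨j, φ, -⟩ := h i
  obtain ⟨o, ho⟩ := hS j fun i => (φ.inp i).eval x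
  exact ⟨_, φ.correct x o ho⟩

theorem log_add_le (m n : ℕ) : Nat.log 2 (m + n) ≤ Nat.log 2 m + Nat.log 2 n + 1 := by
  rcases Nat.eq_zero_or_pos (m + n) with h | h
  · simp [h]
  refine Nat.le_of_lt_succ (Nat.log_lt_of_lt_pow h.ne' ?_)
  have h₁ := Nat.lt_pow_succ_log_self one_lt_two m
  have h₂ := Nat.lt_pow_succ_log_self one_lt_two n
  have h₃ : 2 ^ (Nat.log 2 m + 1) ≤ 2 ^ (Nat.log 2 m + Nat.log 2 n + 1) :=
    Nat.pow_le_pow_right (by omega) (by omega)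
  have h₄ : 2 ^ (Nat.log 2 n + 1) ≤ 2 ^ (Nat.log 2 m + Nat.log 2 n + 1) :=
    Nat.pow_le_pow_right (by omega) (by omega)
  rw [pow_succ 2 (_ + 1)]
  omega

theorem size_inter (R S : SearchFamily) (p : R.Idx × S.Idx) :
    ((R.inter S).prob p).size = (R.prob p.1).size + (S.prob p.2).size :=
  Fintype.card_sum

theorem log_size_le_inter_left (R S : SearchFamily) (p : R.Idx × S.Idx) :
    Nat.log 2 (R.prob p.1).size ≤ Nat.log 2 ((R.inter S).prob p).size :=
  Nat.log_mono_right (by rw [size_inter]; omega)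

theorem log_size_le_inter_right (R S : SearchFamily) (p : R.Idx × S.Idx) :
    Nat.log 2 (S.prob p.2).size ≤ Nat.log 2 ((R.inter S).prob p).size :=
  Nat.log_mono_right (by rw [size_inter]; omega)

/-- Both formulations read the same input of `Q`, and a solution of either component is translated
by the output tree of that component. -/
theorem Reduces.inter {Q R S : SearchFamily} (h₁ : Q ≤dt R) (h₂ : Q ≤dt S) :
    Q ≤dt R.inter S := by
  rw [reduces_iff] at *
  obtain ⟨c₁, k₁, h₁⟩ := h₁
  obtain ⟨c₂, k₂, h₂⟩ := h₂
  refine ⟨c₁ + c₂ + 1, k₁ + k₂, fun i => ?_⟩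
  obtain ⟨j₁, d₁, ⟨F₁, hF₁, hG₁⟩, hc₁⟩ := h₁ i
  obtain ⟨j₂, d₂, ⟨F₂, hF₂, hG₂⟩, hc₂⟩ := h₂ i
  refine ⟨(j₁, j₂), d₁ + d₂, ⟨fun x => Sum.elim (F₁ x) (F₂ x), ?_, ?_⟩, ?_⟩
  · rintro (i | i)
    · exact (hF₁ i).mono (by omega)
    · exact (hF₂ i).mono (by omega)
  · rintro (o | o)
    · obtain ⟨G, hG, h⟩ := hG₁ o
      exact ⟨G, hG.mono (by omega), h⟩
    · obtain ⟨G, hG, h⟩ := hG₂ o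
      exact ⟨G, hG.mono (by omega), h⟩
  · rw [size_inter]
    have := log_add_le (R.prob j₁).size (S.prob j₂).size
    set m := Nat.log 2 (Q.prob i).size + 1
    have h₃ : m ^ k₁ ≤ m ^ (k₁ + k₂) := Nat.pow_le_pow_right (by omega) (by omega)
    have h₄ : m ^ k₂ ≤ m ^ (k₁ + k₂) := Nat.pow_le_pow_right (by omega) (by omega)
    have h₅ : 1 ≤ m ^ (k₁ + k₂) := Nat.one_le_pow _ _ (by omega)
    have h₆ := Nat.mul_le_mul_left c₁ h₃
    have h₇ := Nat.mul_le_mul_left c₂ h₄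
    dsimp only
    linarith

/-! ### Outputs chosen from several candidates -/

/-- Every output is verified by a decision tree of depth at most `d`. -/
def Verifiable (d : ℕ) (R : SearchProblem) : Prop := ∀ o, Comp d fun x => R.Sol x o

theorem Verifiable.mono {R : SearchProblem} {d e : ℕ} (h : Verifiable d R) (hde : d ≤ e) :
    Verifiable e R := fun o => (h o).mono hde

namespace Solves

variable {R : SearchProblem} {d e v : ℕ} {p q : (R.Var → Bool) → Prop}

theorem imp (h : Solves d R p) (hpq : ∀ x, q x → p x) : Solves d R q :=
  let ⟨G, hG, h⟩ := h
  ⟨G, hG, fun x hx => h x (hpq x hx)⟩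

theorem mono (h : Solves d R p) (hde : d ≤ e) : Solves e R p :=
  let ⟨G, hG, h⟩ := h
  ⟨G, hG.mono hde, h⟩

theorem of_comp {G : (R.Var → Bool) → R.Out} (hG : Comp d G) :
    Solves d R fun x => R.Sol x (G x) :=
  ⟨G, hG, fun _ h => h⟩

theorem of_out (o : R.Out) : Solves 0 R fun x => R.Sol x o :=
  of_comp (Comp.const o)

/-- A formulation must commit to one output, whereas the combinatorial arguments only say that one
of several candidates is a solution. The first candidate is computed and tested, and the second is
used if the test fails. -/
theorem or (hR : Verifiable v R) (hp : Solves d R p) (hq : Solves e R q) :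
    Solves (2 * d + e + v) R fun x => p x ∨ q x := by
  classical
  obtain ⟨G, hG, h⟩ := hp
  obtain ⟨G', hG', h'⟩ := hq
  have hv : Comp (d + v) fun x => R.Sol x (G x) := hG.bind (h := fun y x => R.Sol x y) hR
  refine ⟨fun x => if R.Sol x (G x) then G x else G' x, (hv.ite hG hG').mono (by omega),
    fun x hx => ?_⟩
  dsimp only
  split_ifs with hs
  · exact hs
  · exact h' x (hx.resolve_left fun hp => hs (h x hp))

end Solves

/-! ### The families are verifiable, and their parameters are bounded by the input size -/

/-- The number of bits of an entry with values in `[B]`, as a unit of query depth. -/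
abbrev entry (B : ℕ) : ℕ := Nat.clog 2 B + 1

theorem verifiable_sinkOfDAG (N : ℕ+) : Verifiable (20 * entry N) (SinkOfDAG.prob N) := by
  intro (o : Fin _)
  -- The depth stays a metavariable that the combinators fill in while following the formula; only
  -- then is it compared with the generous bound. The next verifiability proofs follow the same
  -- pattern.
  apply Comp.mono
  · unfold SinkOfDAG
    dsimp only
    repeat' first | exact Comp.const _ | apply Comp.read | apply Comp.or | apply Comp.and |
      apply Comp.eq | apply Comp.ne | apply Comp.fin_le
  · simp only [entry]; omega

theorem verifiable_sinkOfLine (N : ℕ+) : Verifiable (20 * entry N) (SinkOfLine.prob N) := by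
  intro (o : Fin _)
  apply Comp.mono
  · unfold SinkOfLine
    dsimp only
    repeat' first | exact Comp.const _ | apply Comp.read | apply Comp.or | apply Comp.and |
      apply Comp.eq | apply Comp.ne
  · simp only [entry]; omega

theorem verifiable_sinkOfPotentialLine (N : ℕ+) :
    Verifiable (20 * entry N) (SinkOfPotentialLine.prob N) := by
  intro (o : Fin _)
  apply Comp.mono
  · unfold SinkOfPotentialLine
    dsimp only
    repeat' first | exact Comp.const _ | apply Comp.read | apply Comp.or | apply Comp.and |
      apply Comp.eq | apply Comp.ne | apply Comp.fin_le
  · simp only [entry]; omega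

theorem verifiable_emptyChildHeight (N : ℕ+) :
    Verifiable (30 * entry N) (EmptyChildHeight.prob N) := by
  intro (o : Fin _)
  apply Comp.mono
  · unfold EmptyChildHeight EmptyChildAt WrongRootAt WrongHeightAt
    dsimp only
    repeat' first | exact Comp.const _ | apply Comp.read | apply Comp.or | apply Comp.and |
      apply Comp.eq | apply Comp.ne | apply Comp.fin_le | apply Comp.lt | apply Comp.add |
      apply Comp.val
  · simp only [entry]; omega

theorem verifiable_lossyCode (N : ℕ+) :
    Verifiable (2 * entry (2 * N)) (LossyCode.prob N) := by
  intro (o : Fin _)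
  have := Nat.clog_mono_right 2 (show (N : ℕ) ≤ 2 * N by omega)
  apply Comp.mono
  · unfold LossyCode
    dsimp only
    repeat' first | exact Comp.const _ | apply Comp.read | apply Comp.ne
  · simp only [entry, PNat.mul_coe, PNat.val_ofNat]; omega

theorem verifiable_bijLossyCode (N : ℕ+) :
    Verifiable (2 * entry (2 * N)) (BijLossyCode.prob N) := by
  have := Nat.clog_mono_right 2 (show (N : ℕ) ≤ 2 * N by omega)
  rintro (o | o)
  all_goals
    apply Comp.mono
    · unfold BijLossyCode
      dsimp only
      repeat' first | exact Comp.const _ | apply Comp.read | apply Comp.ne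
    · simp only [entry, PNat.mul_coe, PNat.val_ofNat]; omega

theorem verifiable_sinkOfMeteredLine (N : ℕ+) :
    Verifiable (40 * entry (N + 1)) (SinkOfMeteredLine.prob N) := by
  intro (o : Fin _)
  have := Nat.clog_mono_right 2 (show (N : ℕ) ≤ N + 1 by omega)
  apply Comp.mono
  · unfold SinkOfMeteredLine SinkOfMeteredLineSol
    dsimp only
    repeat' first | exact Comp.const _ | apply Comp.read | apply Comp.or | apply Comp.and |
      apply Comp.eq | apply Comp.ne | apply Comp.fin_le | apply Comp.lt | apply Comp.add |
      apply Comp.val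
  · simp only [entry]; omega

theorem verifiable_endOfMeteredLine (N : ℕ+) :
    Verifiable (40 * entry (N + 1)) (EndOfMeteredLine.prob N) := by
  intro (o : Fin _)
  have := Nat.clog_mono_right 2 (show (N : ℕ) ≤ N + 1 by omega)
  apply Comp.mono
  · unfold EndOfMeteredLine EndOfMeteredLineSol SinkOfMeteredLineSol
    dsimp only
    repeat' first | exact Comp.const _ | apply Comp.read | apply Comp.or | apply Comp.and |
      apply Comp.eq | apply Comp.ne | apply Comp.fin_le | apply Comp.lt | apply Comp.add |
      apply Comp.val
  · simp only [entry]; omega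

theorem Verifiable.inter {R S : SearchFamily} {i : R.Idx} {j : S.Idx} {d e : ℕ}
    (hR : Verifiable d (R.prob i)) (hS : Verifiable e (S.prob j)) :
    Verifiable (d + e) ((R.inter S).prob (i, j)) := by
  rintro (o | o)
  · exact ((hR o).reindex Sum.inl).mono (by omega)
  · exact ((hS o).reindex Sum.inr).mono (by omega)

theorem entry_le_of_le {n m : ℕ} (h : n ≤ 2 * m) : entry n ≤ 2 * (Nat.log 2 m + 1) + 1 := by
  have h₁ := Nat.lt_pow_succ_log_self one_lt_two m
  have : Nat.clog 2 n ≤ Nat.log 2 m + 2 :=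
    Nat.clog_le_of_le_pow (by rw [pow_succ]; omega)
  unfold entry
  omega

theorem le_mul_clog {a b : ℕ} (h : 2 ≤ b) : a ≤ a * Nat.clog 2 b :=
  Nat.le_mul_of_pos_right _ (Nat.clog_pos one_lt_two h)

/-- A family whose size parameter is at most twice the number of input bits. -/
theorem entry_le_log {n m : ℕ} (h : 2 ≤ n → n ≤ 2 * m) :
    entry n ≤ 3 * (Nat.log 2 m + 1) := by
  rcases Nat.lt_or_ge n 2 with hn | hn
  -- Entries with at most one possible value have no bits, so the input length need not bound `n`
  -- here; a unit of depth is then `1`.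
  · have : Nat.clog 2 n = 0 := Nat.clog_of_right_le_one (by omega) 2
    unfold entry
    omega
  · have := entry_le_of_le (h hn)
    omega

theorem card_tableVar (A B : ℕ) : Fintype.card (TableVar A B) = A * Nat.clog 2 B := by
  simp

theorem size_sinkOfDAG (N : ℕ+) :
    (SinkOfDAG.prob N).size = N * Nat.clog 2 N + N * Nat.clog 2 N := by
  refine (show _ = Fintype.card (TableVar N N ⊕ TableVar N N) from rfl).trans ?_
  simp only [Fintype.card_sum, card_tableVar]

theorem size_sinkOfLine (N : ℕ+) :
    (SinkOfLine.prob N).size = N * Nat.clog 2 N + N * Nat.clog 2 N := by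
  refine (show _ = Fintype.card (TableVar N N ⊕ TableVar N N) from rfl).trans ?_
  simp only [Fintype.card_sum, card_tableVar]

theorem size_sinkOfPotentialLine (N : ℕ+) : (SinkOfPotentialLine.prob N).size =
    N * Nat.clog 2 N + (N * Nat.clog 2 N + N * Nat.clog 2 N) := by
  refine (show _ = Fintype.card (TableVar N N ⊕ TableVar N N ⊕ TableVar N N) from rfl).trans ?_
  simp only [Fintype.card_sum, card_tableVar]

theorem size_emptyChildHeight (N : ℕ+) : (EmptyChildHeight.prob N).size =
    N * Nat.clog 2 N + N * Nat.clog 2 N + (N * Nat.clog 2 N + N * Nat.clog 2 N) := by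
  refine (show _ = Fintype.card (ECwHVar N) from rfl).trans ?_
  simp only [Fintype.card_sum, card_tableVar]

theorem size_binaryEmptyChildHeight (N : ℕ+) : (BinaryEmptyChildHeight.prob N).size =
    N * Nat.clog 2 N + N * Nat.clog 2 N + (N * Nat.clog 2 N + N * Nat.clog 2 N) := by
  refine (show _ = Fintype.card (ECwHVar N) from rfl).trans ?_
  simp only [Fintype.card_sum, card_tableVar]

theorem size_lossyCode (N : ℕ+) : (LossyCode.prob N).size =
    N * Nat.clog 2 (2 * N) + 2 * N * Nat.clog 2 N := by
  refine (show _ = Fintype.card (TableVar N (2 * N : ℕ+) ⊕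
    TableVar (2 * N : ℕ+) N) from rfl).trans ?_
  rw [Fintype.card_sum, card_tableVar, card_tableVar]
  rfl

theorem size_bijLossyCode (N : ℕ+) : (BijLossyCode.prob N).size =
    N * Nat.clog 2 (2 * N) + 2 * N * Nat.clog 2 N := by
  refine (show _ = Fintype.card (TableVar N (2 * N : ℕ+) ⊕
    TableVar (2 * N : ℕ+) N) from rfl).trans ?_
  rw [Fintype.card_sum, card_tableVar, card_tableVar]
  rfl

theorem size_sinkOfMeteredLine (N : ℕ+) : (SinkOfMeteredLine.prob N).size =
    N * Nat.clog 2 N + (N * Nat.clog 2 N + N * Nat.clog 2 (N + 1)) := by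
  refine (show _ = Fintype.card (MeteredLineVar N) from rfl).trans ?_
  simp only [Fintype.card_sum, card_tableVar]

theorem size_endOfMeteredLine (N : ℕ+) : (EndOfMeteredLine.prob N).size =
    N * Nat.clog 2 N + (N * Nat.clog 2 N + N * Nat.clog 2 (N + 1)) := by
  refine (show _ = Fintype.card (MeteredLineVar N) from rfl).trans ?_
  simp only [Fintype.card_sum, card_tableVar]

theorem entry_sinkOfDAG (N : ℕ+) :
    entry N ≤ 3 * (Nat.log 2 (SinkOfDAG.prob N).size + 1) :=
  entry_le_log fun h => by have := le_mul_clog (a := N) h; rw [size_sinkOfDAG]; omega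

theorem entry_sinkOfLine (N : ℕ+) :
    entry N ≤ 3 * (Nat.log 2 (SinkOfLine.prob N).size + 1) :=
  entry_le_log fun h => by have := le_mul_clog (a := N) h; rw [size_sinkOfLine]; omega

theorem entry_sinkOfPotentialLine (N : ℕ+) :
    entry N ≤ 3 * (Nat.log 2 (SinkOfPotentialLine.prob N).size + 1) :=
  entry_le_log fun h => by have := le_mul_clog (a := N) h; rw [size_sinkOfPotentialLine]; omega

theorem entry_emptyChildHeight (N : ℕ+) :
    entry N ≤ 3 * (Nat.log 2 (EmptyChildHeight.prob N).size + 1) :=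
  entry_le_log fun h => by have := le_mul_clog (a := N) h; rw [size_emptyChildHeight]; omega

theorem entry_lossyCode (N : ℕ+) :
    entry (2 * N) ≤ 3 * (Nat.log 2 (LossyCode.prob N).size + 1) :=
  entry_le_log fun h => by have := le_mul_clog (a := N) h; rw [size_lossyCode]; omega

theorem entry_bijLossyCode (N : ℕ+) :
    entry (2 * N) ≤ 3 * (Nat.log 2 (BijLossyCode.prob N).size + 1) :=
  entry_le_log fun h => by have := le_mul_clog (a := N) h; rw [size_bijLossyCode]; omega

theorem entry_sinkOfMeteredLine (N : ℕ+) :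
    entry (N + 1) ≤ 3 * (Nat.log 2 (SinkOfMeteredLine.prob N).size + 1) :=
  entry_le_log fun h => by
    have := le_mul_clog (a := N) h
    have := N.pos
    rw [size_sinkOfMeteredLine]
    omega

theorem entry_endOfMeteredLine (N : ℕ+) :
    entry (N + 1) ≤ 3 * (Nat.log 2 (EndOfMeteredLine.prob N).size + 1) :=
  entry_le_log fun h => by
    have := le_mul_clog (a := N) h
    have := N.pos
    rw [size_endOfMeteredLine]
    omega

theorem log_mul_clog_le {n m a : ℕ} (h : n ≤ 4 * (m * Nat.clog 2 a)) (hm : m ≤ a) :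
    Nat.log 2 n ≤ 2 * Nat.clog 2 a + 2 := by
  have h₁ := Nat.le_pow_clog one_lt_two a
  have h₂ : Nat.clog 2 a < 2 ^ Nat.clog 2 a := Nat.lt_two_pow_self
  have h₃ : m * Nat.clog 2 a ≤ 2 ^ Nat.clog 2 a * 2 ^ Nat.clog 2 a :=
    Nat.mul_le_mul (by omega) h₂.le
  have h₄ : n ≤ 2 ^ (2 * Nat.clog 2 a + 2) := by
    rw [pow_add, two_mul, pow_add]
    omega
  exact (Nat.log_mono_right h₄).trans_eq (Nat.log_pow one_lt_two _)

theorem log_size_sinkOfDAG (N : ℕ+) :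
    Nat.log 2 (SinkOfDAG.prob N).size ≤ 2 * Nat.clog 2 N + 2 :=
  log_mul_clog_le (m := N) (by rw [size_sinkOfDAG]; omega) le_rfl

theorem log_size_sinkOfLine (N : ℕ+) :
    Nat.log 2 (SinkOfLine.prob N).size ≤ 2 * Nat.clog 2 N + 2 :=
  log_mul_clog_le (m := N) (by rw [size_sinkOfLine]; omega) le_rfl

theorem log_size_sinkOfPotentialLine (N : ℕ+) :
    Nat.log 2 (SinkOfPotentialLine.prob N).size ≤ 2 * Nat.clog 2 N + 2 :=
  log_mul_clog_le (m := N) (by rw [size_sinkOfPotentialLine]; omega) le_rfl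

theorem log_size_emptyChildHeight (N : ℕ+) :
    Nat.log 2 (EmptyChildHeight.prob N).size ≤ 2 * Nat.clog 2 N + 2 :=
  log_mul_clog_le (m := N) (by rw [size_emptyChildHeight]; omega) le_rfl

theorem log_size_binaryEmptyChildHeight (N : ℕ+) :
    Nat.log 2 (BinaryEmptyChildHeight.prob N).size ≤ 2 * Nat.clog 2 N + 2 :=
  log_mul_clog_le (m := N) (by rw [size_binaryEmptyChildHeight]; omega) le_rfl

theorem log_size_lossyCode (N : ℕ+) :
    Nat.log 2 (LossyCode.prob N).size ≤ 2 * Nat.clog 2 (2 * N) + 2 := by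
  refine log_mul_clog_le (m := N) ?_ (by omega)
  have h := Nat.clog_mono_right 2 (show (N : ℕ) ≤ 2 * N by omega)
  have := Nat.mul_le_mul_left (N : ℕ) h
  rw [size_lossyCode, mul_assoc]
  omega

theorem log_size_sinkOfMeteredLine (N : ℕ+) :
    Nat.log 2 (SinkOfMeteredLine.prob N).size ≤ 2 * Nat.clog 2 (N + 1) + 2 := by
  refine log_mul_clog_le (m := N) ?_ (by omega)
  have h := Nat.clog_mono_right 2 (show (N : ℕ) ≤ N + 1 by omega)
  have := Nat.mul_le_mul_left (N : ℕ) h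
  rw [size_sinkOfMeteredLine]
  omega

theorem clog_mul_le (a b : ℕ) : Nat.clog 2 (a * b) ≤ Nat.clog 2 a + Nat.clog 2 b :=
  Nat.clog_le_of_le_pow <| by
    rw [pow_add]
    exact Nat.mul_le_mul (Nat.le_pow_clog one_lt_two a) (Nat.le_pow_clog one_lt_two b)

/-! ### Formulations over arbitrary node sets -/

theorem exists_equiv_fin {ν : Type} [Fintype ν] (r : ν) (K : ℕ+) (hK : Fintype.card ν = K) :
    ∃ e : ν ≃ Fin K, e r = 0 := by
  let e := Fintype.equivFinOfCardEq hK
  exact ⟨e.trans (Equiv.swap (e r) 0), by simp⟩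

theorem red_sinkOfPotentialLine {R : SearchProblem} {d : ℕ} {ν : Type} [Fintype ν] (K : ℕ+)
    (hK : Fintype.card ν = K) (r : ν) (S P : (R.Var → Bool) → ν → ν) (V : (R.Var → Bool) → ν → ℕ)
    (hV : ∀ x u, V x u < K) (hS : ∀ u, Comp d fun x => S x u) (hP : ∀ u, Comp d fun x => P x u)
    (hVd : ∀ u, Comp d fun x => V x u)
    (hout : ∀ u, Solves d R fun x =>
      (u = r ∧ (P x r ≠ r ∨ S x r = r ∨ V x r ≠ 0)) ∨ P x (S x u) ≠ u ∨
        (S x u ≠ u ∧ P x (S x u) = u ∧ V x (S x u) ≤ V x u)) :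
    Red d R (SinkOfPotentialLine.prob K) := by
  obtain ⟨e, he⟩ := exists_equiv_fin r K hK
  have hr : e.symm 0 = r := by rw [← he, e.symm_apply_apply]
  have hr' : ∀ u, e u = 0 ↔ u = r := fun u => by rw [← he, e.apply_eq_iff_eq]
  refine ⟨fun x => Sum.elim (writeTable fun a => e (S x (e.symm a)))
    (Sum.elim (writeTable fun a => e (P x (e.symm a)))
      (writeTable fun a => ⟨V x (e.symm a), hV x _⟩)), ?_, fun o => ?_⟩
  · rintro (i | i | i)
    · exact Comp.writeTable (fun a => (hS _).map e) i
    · exact Comp.writeTable (fun a => (hP _).map e) i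
    · exact Comp.writeTable (fun a => (hVd _).fin_mk (hV · _)) i
  · obtain ⟨u, rfl⟩ := e.surjective o
    refine (hout u).imp fun x hx => ?_
    simpa [SinkOfPotentialLine, hr, hr'] using hx

theorem red_sinkOfMeteredLine {R : SearchProblem} {d : ℕ} {ν : Type} [Fintype ν] (K : ℕ+)
    (hK : Fintype.card ν = K) (r : ν) (S P : (R.Var → Bool) → ν → ν) (V : (R.Var → Bool) → ν → ℕ)
    (hV : ∀ x u, V x u < K + 1) (hS : ∀ u, Comp d fun x => S x u)
    (hP : ∀ u, Comp d fun x => P x u) (hVd : ∀ u, Comp d fun x => V x u)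
    (hout : ∀ u, Solves d R fun x =>
      (u = r ∧ (P x r ≠ r ∨ S x r = r ∨ V x r ≠ 1)) ∨ P x (S x u) ≠ u ∨ (u ≠ r ∧ V x u = 1) ∨
        (0 < V x u ∧ V x (S x u) ≠ V x u + 1) ∨ (1 < V x u ∧ V x u ≠ V x (P x u) + 1)) :
    Red d R (SinkOfMeteredLine.prob K) := by
  obtain ⟨e, he⟩ := exists_equiv_fin r K hK
  have hr : e.symm 0 = r := by rw [← he, e.symm_apply_apply]
  have hr' : ∀ u, e u = 0 ↔ u = r := fun u => by rw [← he, e.apply_eq_iff_eq]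
  refine ⟨fun x => Sum.elim (writeTable fun a => e (S x (e.symm a)))
    (Sum.elim (writeTable fun a => e (P x (e.symm a)))
      (writeTable fun a => ⟨V x (e.symm a), hV x _⟩)), ?_, fun o => ?_⟩
  · rintro (i | i | i)
    · exact Comp.writeTable (fun a => (hS _).map e) i
    · exact Comp.writeTable (fun a => (hP _).map e) i
    · exact Comp.writeTable (fun a => (hVd _).fin_mk (hV · _)) i
  · obtain ⟨u, rfl⟩ := e.surjective o
    refine (hout u).imp fun x hx => ?_
    simpa [SinkOfMeteredLine, SinkOfMeteredLineSol, hr, hr'] using hx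

/-- Here `h` is the raw table entry, one less than the height, which is why the root condition is `h
x r ≠ 0`. -/
theorem red_emptyChildHeight {R : SearchProblem} {d : ℕ} {ν : Type} [Fintype ν] (K : ℕ+)
    (hK : Fintype.card ν = K) (r : ν) (F L R' : (R.Var → Bool) → ν → ν)
    (h : (R.Var → Bool) → ν → ℕ) (hh : ∀ x u, h x u < K) (hF : ∀ u, Comp d fun x => F x u)
    (hL : ∀ u, Comp d fun x => L x u) (hR : ∀ u, Comp d fun x => R' x u)
    (hhd : ∀ u, Comp d fun x => h x u)
    (hout : ∀ u, Solves d R fun x =>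
      (F x (L x u) ≠ u ∨ F x (R' x u) ≠ u ∨ (L x u = R' x u ∧ R' x u ≠ u)) ∨
      (u = r ∧ (L x r = r ∨ R' x r = r ∨ F x r ≠ r)) ∨
      ((u ≠ r ∧ u ≠ F x u ∧ h x u ≠ h x (F x u) + 1) ∨ (u = r ∧ h x r ≠ 0))) :
    Red d R (EmptyChildHeight.prob K) := by
  obtain ⟨e, he⟩ := exists_equiv_fin r K hK
  have hr : e.symm 0 = r := by rw [← he, e.symm_apply_apply]
  have hr' : ∀ u, e u = 0 ↔ u = r := fun u => by rw [← he, e.apply_eq_iff_eq]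
  refine ⟨fun x => Sum.elim
    (Sum.elim (writeTable fun a => e (F x (e.symm a))) (writeTable fun a => e (L x (e.symm a))))
    (Sum.elim (writeTable fun a => e (R' x (e.symm a)))
      (writeTable fun a => ⟨h x (e.symm a), hh x _⟩)), ?_, fun o => ?_⟩
  · rintro ((i | i) | i | i)
    · exact Comp.writeTable (fun a => (hF _).map e) i
    · exact Comp.writeTable (fun a => (hL _).map e) i
    · exact Comp.writeTable (fun a => (hR _).map e) i
    · exact Comp.writeTable (fun a => (hhd _).fin_mk (hh · _)) i
  · obtain ⟨u, rfl⟩ := e.surjective o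
    refine (hout u).imp fun x hx => ?_
    simpa [EmptyChildHeight, EmptyChildAt, WrongRootAt, WrongHeightAt, hr, hr'] using hx

theorem red_binaryEmptyChildHeight {R : SearchProblem} {d : ℕ} {ν : Type} [Fintype ν] (K : ℕ+)
    (hK : Fintype.card ν = K) (r : ν) (F L R' : (R.Var → Bool) → ν → ν)
    (h : (R.Var → Bool) → ν → ℕ) (hh : ∀ x u, h x u < K) (hF : ∀ u, Comp d fun x => F x u)
    (hL : ∀ u, Comp d fun x => L x u) (hR : ∀ u, Comp d fun x => R' x u)
    (hhd : ∀ u, Comp d fun x => h x u)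
    (hout : ∀ u, Solves d R fun x =>
      (F x (L x u) ≠ u ∨ F x (R' x u) ≠ u ∨ (L x u = R' x u ∧ R' x u ≠ u)) ∨
      (u = r ∧ (L x r = r ∨ R' x r = r ∨ F x r ≠ r)) ∨
      (u ≠ r ∧ u ≠ L x (F x u) ∧ u ≠ R' x (F x u)) ∨
      ((u ≠ r ∧ u ≠ F x u ∧ h x u ≠ h x (F x u) + 1) ∨ (u = r ∧ h x r ≠ 0))) :
    Red d R (BinaryEmptyChildHeight.prob K) := by
  obtain ⟨e, he⟩ := exists_equiv_fin r K hK
  have hr : e.symm 0 = r := by rw [← he, e.symm_apply_apply]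
  have hr' : ∀ u, e u = 0 ↔ u = r := fun u => by rw [← he, e.apply_eq_iff_eq]
  refine ⟨fun x => Sum.elim
    (Sum.elim (writeTable fun a => e (F x (e.symm a))) (writeTable fun a => e (L x (e.symm a))))
    (Sum.elim (writeTable fun a => e (R' x (e.symm a)))
      (writeTable fun a => ⟨h x (e.symm a), hh x _⟩)), ?_, fun o => ?_⟩
  · rintro ((i | i) | i | i)
    · exact Comp.writeTable (fun a => (hF _).map e) i
    · exact Comp.writeTable (fun a => (hL _).map e) i
    · exact Comp.writeTable (fun a => (hR _).map e) i
    · exact Comp.writeTable (fun a => (hhd _).fin_mk (hh · _)) i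
  · obtain ⟨u, rfl⟩ := e.surjective o
    refine (hout u).imp fun x hx => ?_
    simpa [BinaryEmptyChildHeight, EmptyChildAt, WrongRootAt, WrongFatherAt, WrongHeightAt, hr,
      hr'] using hx

/-! ### Totality and the reductions that keep the node set -/

theorem isTotal_sinkOfPotentialLine : IsTotal SinkOfPotentialLine := by
  intro (N : ℕ+) z
  by_contra! h
  simp only [SinkOfPotentialLine, not_or, not_and, not_not, not_le] at h
  set S : Fin N → Fin N := readTable fun i => z (Sum.inl i)
  set P : Fin N → Fin N := readTable fun i => z (Sum.inr (Sum.inl i))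
  set V : Fin N → Fin N := readTable fun i => z (Sum.inr (Sum.inr i))
  have key : ∀ k : ℕ, S (S^[k] 0) ≠ S^[k] 0 ∧ k ≤ (V (S^[k] 0) : ℕ) := by
    intro k
    induction k with
    | zero => exact ⟨((h (0 : Fin N)).1 rfl).2.1, Nat.zero_le _⟩
    | succ k ih =>
      rw [Function.iterate_succ_apply']
      generalize S^[k] 0 = y at ih
      -- If `S y` were a fixed point of `S`, then `P (S y)` would be both `y` and `S y`. So the line
      -- from the source never stops, while its potential stays below `N`.
      refine ⟨fun hy => ih.1 ?_, ?_⟩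
      · have h₁ := (h y).2.1
        have h₂ := (h (S y)).2.1
        rw [hy, h₁] at h₂
        exact h₂.symm
      · have := (h y).2.2 ih.1 (h y).2.1
        rw [Fin.lt_def] at this
        omega
  have := (key N).2
  have := (V (S^[N] 0)).2
  omega

theorem sinkOfPotentialLine_reduces_sinkOfLine : SinkOfPotentialLine ≤dt SinkOfLine := by
  refine reduces_iff.2 ⟨10, 1, fun N : ℕ+ => ⟨N, 1, ⟨fun x => Sum.elim (fun i => x (Sum.inl i))
    (fun i => x (Sum.inr (Sum.inl i))), ?_, fun o =>
      ((Solves.of_out (R := SinkOfPotentialLine.prob N) o).mono (Nat.zero_le 1)).imp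
        fun x hx => ?_⟩, ?_⟩⟩
  · rintro (i | i) <;> exact Comp.bit _
  · rcases hx with ⟨h₁, h₂ | h₂⟩ | h₁
    · exact .inl ⟨h₁, .inl h₂⟩
    · exact .inl ⟨h₁, .inr (.inl h₂)⟩
    · exact .inr (.inl h₁)
  · have := log_size_sinkOfLine N
    have := entry_sinkOfPotentialLine N
    unfold entry at this
    rw [pow_one]
    omega

/-- Edges not confirmed by `P` are replaced by self-loops. If an edge from `o` ends in a sink of the
new graph, then the edge out of `S o` was cut, so `S o` is a solution: a genuine self-loop at `S o`
is impossible, as `P (S o) = o`. -/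
theorem sinkOfPotentialLine_reduces_sinkOfDAG : SinkOfPotentialLine ≤dt SinkOfDAG := by
  refine reduces_iff.2 ⟨100, 1, fun N : ℕ+ => ⟨N, 22 * entry N, ?_, ?_⟩⟩
  · let S (x : (SinkOfPotentialLine.prob N).Var → Bool) : Fin N → Fin N :=
      readTable fun i => x (Sum.inl i)
    let P (x : (SinkOfPotentialLine.prob N).Var → Bool) : Fin N → Fin N :=
      readTable fun i => x (Sum.inr (Sum.inl i))
    have hS : ∀ a, Comp (entry N) fun x => S x a := fun a =>
      (Comp.const a).read.mono (by unfold entry; omega)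
    have hP : ∀ a, Comp (2 * entry N) fun x => P x (S x a) := fun a =>
      (Comp.const a).read.read.mono (by unfold entry; omega)
    refine ⟨fun x => Sum.elim (writeTable fun a => if P x (S x a) = a then S x a else a)
      (fun i => x (Sum.inr (Sum.inr i))), ?_, fun (o : Fin N) => ?_⟩
    · rintro (i | i)
      · exact Comp.writeTable (fun a => (((hP a).eq (Comp.const a)).ite (hS a)
          (Comp.const a)).mono (b := 22 * entry N) (by simp; omega)) i
      · exact (Comp.bit _).mono (by unfold entry; omega)
    · refine ((Solves.of_out o).or (verifiable_sinkOfPotentialLine N)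
        (Solves.of_comp (hS o))).mono (by omega) |>.imp fun x hx => ?_
      simp only [SinkOfDAG, Sum.elim_inl, Sum.elim_inr, readTable_writeTable] at hx
      simp only [SinkOfPotentialLine]
      change _ ∨ _ at hx
      set V : Fin N → Fin N := readTable fun i => x (Sum.inr (Sum.inr i))
      change (o = 0 ∧ (P x 0 ≠ 0 ∨ S x 0 = 0 ∨ V 0 ≠ 0) ∨ P x (S x o) ≠ o ∨
        (S x o ≠ o ∧ P x (S x o) = o ∧ V (S x o) ≤ V o)) ∨
        (S x o = 0 ∧ _ ∨ P x (S x (S x o)) ≠ S x o ∨ _)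
      generalize S x = S, P x = P at *
      by_cases h₁ : P (S o) = o
      · by_cases h₂ : P (S (S o)) = S o
        · simp only [h₁, h₂, if_true] at hx
          rcases hx with ⟨rfl, h₀⟩ | ⟨h₃, h₄⟩ | ⟨h₃, h₄⟩
          · by_cases h₅ : P (S 0) = 0
            · simp only [h₅, if_true] at h₀
              exact .inl (.inl ⟨rfl, .inr (.inl h₀)⟩)
            · exact .inl (.inr (.inl h₅))
          · rw [h₄, h₁] at h₂
            exact absurd h₂.symm h₃
          · exact .inl (.inr (.inr ⟨h₃, h₁, h₄⟩))
        · exact .inr (.inr (.inl h₂))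
      · exact .inl (.inr (.inl h₁))
  · have := log_size_sinkOfDAG N
    have := entry_sinkOfPotentialLine N
    unfold entry at *
    rw [pow_one]
    omega

/-- The line runs along left children. A defect at `o` shows up in the tree at `o`, at its left
child or at the root, and these three candidates are tested. -/
theorem emptyChildHeight_reduces_sinkOfPotentialLine :
    EmptyChildHeight ≤dt SinkOfPotentialLine := by
  refine reduces_iff.2 ⟨1000, 1, fun N : ℕ+ => ⟨N, 70 * entry N, ?_, ?_⟩⟩
  · let F (x : (EmptyChildHeight.prob N).Var → Bool) : Fin N → Fin N :=
      readTable fun i => x (Sum.inl (Sum.inl i))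
    let L (x : (EmptyChildHeight.prob N).Var → Bool) : Fin N → Fin N :=
      readTable fun i => x (Sum.inl (Sum.inr i))
    have hL : ∀ a, Comp (entry N) fun x => L x a := fun a =>
      (Comp.const a).read.mono (by unfold entry; omega)
    refine ⟨fun x => Sum.elim (fun i => x (Sum.inl (Sum.inr i)))
      (Sum.elim (fun i => x (Sum.inl (Sum.inl i))) (fun i => x (Sum.inr (Sum.inr i)))), ?_,
      fun (o : Fin N) => ?_⟩
    · rintro (i | i | i) <;> exact (Comp.bit _).mono (by unfold entry; omega)
    · refine ((Solves.of_out o).or (verifiable_emptyChildHeight N)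
        ((Solves.of_comp (hL o)).or (verifiable_emptyChildHeight N)
          (Solves.of_out (0 : Fin N)))).mono (by omega) |>.imp fun x hx => ?_
      simp only [SinkOfPotentialLine, Sum.elim_inl, Sum.elim_inr] at hx
      simp only [EmptyChildHeight]
      set H : Fin N → Fin N := readTable fun i => x (Sum.inr (Sum.inr i))
      set R : Fin N → Fin N := readTable fun i => x (Sum.inr (Sum.inl i))
      change _ ∨ (F x (L x o) ≠ o) ∨ (L x o ≠ o ∧ F x (L x o) = o ∧ H (L x o) ≤ H o) at hx
      change (EmptyChildAt (F x) (L x) R o ∨ _ ∨ _) ∨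
        (_ ∨ _ ∨ WrongHeightAt (F x) (fun v => (H v : ℕ) + 1) (L x o)) ∨
        (_ ∨ WrongRootAt (F x) (L x) R 0 ∨ WrongHeightAt (F x) (fun v => (H v : ℕ) + 1) 0)
      rcases hx with ⟨-, h₁ | h₁ | h₁⟩ | h₁ | ⟨h₁, h₂, h₃⟩
      · exact .inr (.inr (.inr (.inl ⟨rfl, .inr (.inr h₁)⟩)))
      · exact .inr (.inr (.inr (.inl ⟨rfl, .inl h₁⟩)))
      · refine .inr (.inr (.inr (.inr (.inr ⟨rfl, fun h => h₁ (Fin.ext ?_)⟩))))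
        simpa using h
      · exact .inl (.inl (.inl h₁))
      -- Heights are not compared at the root, but an edge into it gives the root a father other
      -- than itself.
      · by_cases h₄ : L x o = 0
        · refine .inr (.inr (.inr (.inl ⟨rfl, .inr (.inr ?_)⟩)))
          rw [h₄] at h₁ h₂
          rwa [h₂, ne_comm]
        · refine .inr (.inl (.inr (.inr (.inl ⟨h₄, ?_, ?_⟩))))
          · rwa [h₂]
          · rw [h₂]
            rw [Fin.le_def] at h₃
            dsimp only
            omega
  · have := log_size_sinkOfPotentialLine N
    have := entry_emptyChildHeight N
    unfold entry at *
    rw [pow_one]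
    omega

theorem isTotal_emptyChildHeight : IsTotal EmptyChildHeight :=
  isTotal_sinkOfPotentialLine.of_reduces emptyChildHeight_reduces_sinkOfPotentialLine

theorem emptyChildHeight_mem_TFNPdt : EmptyChildHeight ∈ TFNPdt := by
  classical
  refine ⟨isTotal_emptyChildHeight, 90 * 2 ^ 1, 1, fun (N : ℕ+) o => ?_⟩
  obtain ⟨T, hT, h⟩ := (verifiable_emptyChildHeight N o).map fun p => decide p
  refine ⟨T, hT.trans (le_trans ?_ (le_polylog 90 1 _)), fun x => by simp [h]⟩
  have := entry_emptyChildHeight N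
  rw [pow_one]
  omega

/-! ### `Sink-Of-DAG ∩ Sink-Of-Line` reduces to `Sink-Of-Potential-Line`

Every node `v` of the DAG is replaced by a block of `n * N + 1` layers with `N` nodes each.
Inside a block the lines move from layer to layer by the injection `S : [N] → [N] \ {1}`, so that
the node `1` of every layer but the first is free: the copy `(v', x)` of a line that leaves the
block of a predecessor `v'` enters at the node `1` of the layer `(v', x) + 1`. -/

section DAGLine

variable {n N : ℕ} [NeZero n] [NeZero N]

/-- The nodes of the layered blocks. -/
abbrev BlockNode (n N : ℕ) : Type := Fin n × Fin (n * N + 1) × Fin N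

/-- The successor in the layered blocks, for a DAG `T` and a line with successor `S`. -/
def blockSucc (T : Fin n → Fin n) (S : Fin N → Fin N) (u : BlockNode n N) : BlockNode n N :=
  if T u.1 = u.1 then u else
    Fin.lastCases (motive := fun _ => BlockNode n N)
      (T u.1, (finProdFinEquiv (u.1, u.2.2)).succ, 0) (fun s => (u.1, s.succ, S u.2.2)) u.2.1

/-- The predecessor in the layered blocks. -/
def blockPred (T : Fin n → Fin n) (S P : Fin N → Fin N) (u : BlockNode n N) : BlockNode n N :=
  if T u.1 = u.1 then u else
    Fin.cases (motive := fun _ => BlockNode n N) u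
      (fun s => if u.2.2 = 0 then
          if T (finProdFinEquiv.symm s).1 = u.1 ∧
              ¬ T (finProdFinEquiv.symm s).1 = (finProdFinEquiv.symm s).1 then
            ((finProdFinEquiv.symm s).1, Fin.last _, (finProdFinEquiv.symm s).2) else u
        else if S (P u.2.2) = u.2.2 then (u.1, s.castSucc, P u.2.2) else u) u.2.1

/-- The potential in the layered blocks, for a potential `W` of the DAG. -/
def blockPotential (W : Fin n → Fin n) (u : BlockNode n N) : ℕ :=
  if u = (0, 0, 0) then 0 else W u.1 * (n * N + 1) + u.2.1

theorem blockPotential_lt (W : Fin n → Fin n) (u : BlockNode n N) :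
    blockPotential W u < n * ((n * N + 1) * N) := by
  have h₁ := (W u.1).2
  have h₂ := u.2.1.2
  have h₃ : blockPotential W u ≤ W u.1 * (n * N + 1) + u.2.1 := by
    unfold blockPotential
    split_ifs <;> omega
  have h₄ : ((W u.1 : ℕ) + 1) * (n * N + 1) ≤ n * (n * N + 1) := Nat.mul_le_mul_right _ h₁
  have h₅ : n * (n * N + 1) ≤ n * ((n * N + 1) * N) :=
    Nat.mul_le_mul_left _ (Nat.le_mul_of_pos_right _ (NeZero.pos N))
  rw [add_mul] at h₄
  omega

/-- There is one layer after the first for each pair of a DAG node and a line node, so all arriving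
lines enter at distinct nodes. Blocks at fixed points of `T` are isolated, hence a line stops only
where the DAG has a sink or where `S` fails to be injective or fails to avoid `0`. The potential
orders nodes by `W` and then by layer. -/
theorem block_solution (T W : Fin n → Fin n) (S P : Fin N → Fin N) (u : BlockNode n N)
    (h : (u = (0, 0, 0) ∧ (blockPred T S P (0, 0, 0) ≠ (0, 0, 0) ∨
        blockSucc T S (0, 0, 0) = (0, 0, 0) ∨ blockPotential W ((0, 0, 0) : BlockNode n N) ≠ 0)) ∨
      blockPred T S P (blockSucc T S u) ≠ u ∨
      (blockSucc T S u ≠ u ∧ blockPred T S P (blockSucc T S u) = u ∧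
        blockPotential W (blockSucc T S u) ≤ blockPotential W u)) :
    ((u.1 = 0 ∧ T 0 = 0) ∨ (T u.1 ≠ u.1 ∧ T (T u.1) = T u.1) ∨
      (T u.1 ≠ u.1 ∧ W (T u.1) ≤ W u.1)) ∨
    ((u.2.2 = 0 ∧ (P 0 ≠ 0 ∨ S 0 = 0)) ∨ P (S u.2.2) ≠ u.2.2) ∨
    (((0 : Fin N) = 0 ∧ (P 0 ≠ 0 ∨ S 0 = 0)) ∨ P (S 0) ≠ 0) := by
  by_contra hn
  simp only [not_or, not_and, not_not, true_imp_iff, not_le] at hn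
  obtain ⟨⟨hT0, hT1, hT2⟩, ⟨-, hPS⟩, ⟨hP0, hS0⟩, -⟩ := hn
  obtain ⟨v, t, a⟩ := u
  dsimp only at hT0 hT1 hT2 hPS
  by_cases hv : T v = v
  · have h₁ : blockSucc T S (v, t, a) = (v, t, a) := by simp [blockSucc, hv]
    have h₂ : blockPred T S P (v, t, a) = (v, t, a) := by simp [blockPred, hv]
    rcases h with ⟨h, -⟩ | h | h
    · obtain rfl : v = 0 := congrArg Prod.fst h
      exact hT0 rfl hv
    · exact h (by rw [h₁, h₂])
    · exact h.1 h₁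
  have hT1 := hT1 hv
  have hT2 := hT2 hv
  -- This keeps `0` free for arriving lines: `S a = 0` gives `a = P 0 = 0`, a source without a
  -- successor.
  have hSa : S a ≠ 0 := fun h0 => by
    rw [h0, hP0] at hPS
    subst hPS
    exact hS0 h0
  have key : blockPred T S P (blockSucc T S (v, t, a)) = (v, t, a) ∧
      blockPotential W (v, t, a) < blockPotential W (blockSucc T S (v, t, a)) := by
    -- Only an inequality, because the potential is reset to `0` at the root; no edge below ends
    -- there.
    have hle : ∀ t' : Fin (n * N + 1), ∀ a' : Fin N, blockPotential W (v, t', a') ≤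
        W v * (n * N + 1) + t' := by
      intro t' a'
      unfold blockPotential
      split_ifs <;> simp
    induction t using Fin.lastCases with
    | last =>
      have h₁ : blockSucc T S (v, Fin.last _, a) = (T v, (finProdFinEquiv (v, a)).succ, 0) := by
        simp [blockSucc, hv]
      refine ⟨?_, (hle _ _).trans_lt ?_⟩
      · rw [h₁]
        simp [blockPred, hT1, hv, -finProdFinEquiv_symm_apply]
      · rw [h₁]
        -- One unit of `W` outweighs all the layers of a block.
        have h₂ : ((W v : ℕ) + 1) * (n * N + 1) ≤ W (T v) * (n * N + 1) :=
          Nat.mul_le_mul_right _ hT2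
        rw [add_mul] at h₂
        simp only [blockPotential, Prod.mk.injEq, Fin.succ_ne_zero, false_and, and_false,
          if_false, Fin.val_last, Fin.val_succ]
        omega
    | cast s =>
      have h₁ : blockSucc T S (v, s.castSucc, a) = (v, s.succ, S a) := by
        simp [blockSucc, hv]
      refine ⟨?_, (hle _ _).trans_lt ?_⟩
      · rw [h₁]
        simp [blockPred, hv, hSa, hPS]
      · rw [h₁]
        simp [blockPotential, Fin.succ_ne_zero]
  rcases h with ⟨h, h'⟩ | h | h
  · rw [h] at key
    rcases h' with h' | h' | h'
    · obtain rfl : v = 0 := congrArg Prod.fst h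
      exact h' (by simp [blockPred, hv])
    · rw [h'] at key
      exact lt_irrefl _ key.2
    · exact h' (by simp [blockPotential])
  · exact h key.1
  · exact absurd key.2 (not_lt.2 h.2.2)

end DAGLine

theorem sinkOfDAG_inter_sinkOfLine_reduces :
    SinkOfDAG.inter SinkOfLine ≤dt SinkOfPotentialLine := by
  refine reduces_iff.2 ⟨10000, 1, fun ⟨(n : ℕ+), (N : ℕ+)⟩ => ?_⟩
  let K : ℕ+ := n * ((n * N + 1) * N)
  have hKc : Nat.clog 2 K ≤ 3 * entry n + 3 * entry N := by
    have h₁ := clog_mul_le n ((n * N + 1) * N)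
    have h₂ := clog_mul_le (n * N + 1) N
    have h₃ := clog_mul_le (2 * n) N
    have h₄ := clog_mul_le 2 n
    have h₅ : Nat.clog 2 (n * N + 1) ≤ Nat.clog 2 (2 * n * N) := by
      refine Nat.clog_mono_right 2 ?_
      have := Nat.mul_pos n.pos N.pos
      rw [mul_assoc]
      omega
    have h₆ : Nat.clog 2 2 = 1 := Nat.clog_pow 2 1 one_lt_two
    simp only [K, PNat.mul_coe, PNat.add_coe, PNat.one_coe, entry] at *
    omega
  refine ⟨K, 100 * (entry n + entry N), ?_, ?_⟩
  · let X := (((SinkOfDAG.inter SinkOfLine).prob (n, N)).Var → Bool)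
    let T (x : X) : Fin n → Fin n := readTable fun i => x (Sum.inl (Sum.inl i))
    let W (x : X) : Fin n → Fin n := readTable fun i => x (Sum.inl (Sum.inr i))
    let S (x : X) : Fin N → Fin N := readTable fun i => x (Sum.inr (Sum.inl i))
    let P (x : X) : Fin N → Fin N := readTable fun i => x (Sum.inr (Sum.inr i))
    have hT : ∀ v, Comp (entry n) fun x => T x v := fun v =>
      (Comp.const v).read.mono (by unfold entry; omega)
    have hW : ∀ v, Comp (entry n) fun x => W x v := fun v =>
      (Comp.const v).read.mono (by unfold entry; omega)
    have hS : ∀ a, Comp (entry N) fun x => S x a := fun a =>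
      (Comp.const a).read.mono (by unfold entry; omega)
    have hP : ∀ a, Comp (entry N) fun x => P x a := fun a =>
      (Comp.const a).read.mono (by unfold entry; omega)
    have hSP : ∀ a, Comp (2 * entry N) fun x => S x (P x a) := fun a =>
      (Comp.const a).read.read.mono (by unfold entry; omega)
    refine red_sinkOfPotentialLine K (by simp [K]) ((0, 0, 0) : BlockNode n N)
      (fun x => blockSucc (T x) (S x)) (fun x => blockPred (T x) (S x) (P x))
      (fun x => blockPotential (W x)) (fun x u => ?_) (fun ⟨v, t, a⟩ => ?_) (fun ⟨v, t, a⟩ => ?_)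
      (fun ⟨v, t, a⟩ => ?_) (fun ⟨v, t, a⟩ => ?_)
    · simpa [K] using blockPotential_lt (W x) u
    · unfold blockSucc
      refine Comp.mono (((hT v).eq (Comp.const v)).ite (Comp.const _)
        (b := 0) (c := entry n + entry N) ?_) (by simp; omega)
      induction t using Fin.lastCases with
      | last =>
        simp only [Fin.lastCases_last]
        exact ((hT v).pair (Comp.const _)).mono (by omega)
      | cast s =>
        simp only [Fin.lastCases_castSucc]
        exact ((Comp.const _).pair ((Comp.const _).pair (hS a))).mono (by omega)
    · unfold blockPred
      refine Comp.mono (((hT v).eq (Comp.const v)).ite (Comp.const _)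
        (b := 0) (c := 10 * (entry n + entry N)) ?_) (by simp; omega)
      induction t using Fin.cases with
      | zero => exact (Comp.const _).mono (by omega)
      | succ s =>
        simp only [Fin.cases_succ]
        split_ifs
        · exact ((((hT _).eq (Comp.const v)).and ((hT _).eq (Comp.const _)).not).ite (Comp.const _)
            (Comp.const _)).mono (by simp; omega)
        · exact (((hSP a).eq (Comp.const a)).ite
            ((Comp.const v).pair ((Comp.const _).pair (hP a))) (Comp.const _)).mono
            (by simp; omega)
    · unfold blockPotential
      split_ifs
      · exact (Comp.const _).mono (by omega)
      · exact Comp.mono (a := entry n) ((hW v).map fun w : Fin n =>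
          (w : ℕ) * (n * N + 1) + t) (by omega)
    · have hv := (verifiable_sinkOfDAG n).inter (verifiable_sinkOfLine N)
      refine ((Solves.of_out (R := (SinkOfDAG.inter SinkOfLine).prob (n, N)) (Sum.inl v)).or hv
        ((Solves.of_out (Sum.inr a)).or hv (Solves.of_out (Sum.inr (0 : Fin N))))).mono
        (e := 100 * (entry n + entry N)) (by omega) |>.imp fun x hx => ?_
      exact block_solution (T x) (W x) (S x) (P x) (v, t, a) hx
  · have h₁ := log_size_sinkOfPotentialLine K
    have h₂ := entry_sinkOfDAG n
    have h₃ := entry_sinkOfLine N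
    have h₄ := log_size_le_inter_left SinkOfDAG SinkOfLine (n, N)
    have h₅ := log_size_le_inter_right SinkOfDAG SinkOfLine (n, N)
    dsimp only at h₄ h₅
    rw [pow_one]
    omega

/-- The difficult inclusion passes through the intersection problem, to which everything in both
classes reduces. -/
theorem SOPL_eq_PLS_inter_PPADS : SOPL = PLS ∩ PPADS := by
  ext Q
  constructor
  · rintro ⟨hQ, h⟩
    exact ⟨⟨hQ, h.trans sinkOfPotentialLine_reduces_sinkOfDAG⟩,
      ⟨hQ, h.trans sinkOfPotentialLine_reduces_sinkOfLine⟩⟩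
  · rintro ⟨⟨hQ, h₁⟩, -, h₂⟩
    exact ⟨hQ, (h₁.inter h₂).trans sinkOfDAG_inter_sinkOfLine_reduces⟩

/-! ### `Sink-Of-Potential-Line` reduces to `Sink-Of-Metered-Line`

An edge from `p` to `y` is subdivided into the nodes `(y, t)` with `V p < t ≤ V y`; if `y` is the
start of a line other than the source, then the nodes `(y, t)` with `1 ≤ t ≤ V y` lead to it. -/

section Subdivision

variable {N : ℕ} [NeZero N]

/-- `x` has a successor on a line, with a larger potential. -/
def GoodEdge (S P V : Fin N → Fin N) (x : Fin N) : Prop :=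
  S x ≠ x ∧ P (S x) = x ∧ (V x : ℕ) < V (S x)

/-- `y` has a predecessor on a line, with a smaller potential. -/
def HasPred (S P V : Fin N → Fin N) (y : Fin N) : Prop :=
  GoodEdge S P V (P y) ∧ S (P y) = y

/-- The nodes of the subdivided lines. -/
def OnSubdivision (S P V : Fin N → Fin N) (u : Fin N × Fin N) : Prop :=
  u = (0, 0) ∨ (u.2 ≠ 0 ∧ (u.2 : ℕ) ≤ V u.1 ∧ S u.1 ≠ u.1 ∧
    (HasPred S P V u.1 → (V (P u.1) : ℕ) < u.2))

open Classical in
/-- The successor on the subdivided lines. -/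
noncomputable def subdivSucc (S P V : Fin N → Fin N) (u : Fin N × Fin N) : Fin N × Fin N :=
  if OnSubdivision S P V u then
    if (u.2 : ℕ) < V u.1 then (u.1, Fin.ofNat N (u.2 + 1)) else (S u.1, Fin.ofNat N (u.2 + 1))
  else u

open Classical in
/-- The predecessor on the subdivided lines. -/
noncomputable def subdivPred (S P V : Fin N → Fin N) (u : Fin N × Fin N) : Fin N × Fin N :=
  if OnSubdivision S P V u then
    if (u.2 : ℕ) ≤ 1 then (0, 0)
    else if HasPred S P V u.1 ∧ (V (P u.1) : ℕ) = u.2 - 1 then (P u.1, Fin.ofNat N (u.2 - 1))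
    else (u.1, Fin.ofNat N (u.2 - 1))
  else u

open Classical in
/-- The meter of the subdivided lines. -/
noncomputable def subdivMeter (S P V : Fin N → Fin N) (u : Fin N × Fin N) : ℕ :=
  if OnSubdivision S P V u then u.2 + 1 else 0

/-- The meter of `(y, t)` is `t + 1`, so it grows by one at each step. Lines that do not start at
the source are the delicate point: a non-root node of meter `1` would be a solution, and so would a
predecessor with the wrong meter. They are therefore prolonged down to `t = 1`, where the
predecessor is declared to be the root. This is harmless, since only `P (S x) = x` is required and
not `S (P x) = x`. -/
theorem subdiv_solution (S P V : Fin N → Fin N) (u : Fin N × Fin N)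
    (h : (u = (0, 0) ∧ (subdivPred S P V (0, 0) ≠ (0, 0) ∨ subdivSucc S P V (0, 0) = (0, 0) ∨
        subdivMeter S P V (0, 0) ≠ 1)) ∨
      subdivPred S P V (subdivSucc S P V u) ≠ u ∨ (u ≠ (0, 0) ∧ subdivMeter S P V u = 1) ∨
      (0 < subdivMeter S P V u ∧
        subdivMeter S P V (subdivSucc S P V u) ≠ subdivMeter S P V u + 1) ∨
      (1 < subdivMeter S P V u ∧
        subdivMeter S P V u ≠ subdivMeter S P V (subdivPred S P V u) + 1)) :
    let Sol (x : Fin N) := (x = 0 ∧ (P 0 ≠ 0 ∨ S 0 = 0 ∨ V 0 ≠ 0)) ∨ P (S x) ≠ x ∨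
      (S x ≠ x ∧ P (S x) = x ∧ V (S x) ≤ V x)
    Sol u.1 ∨ Sol (S u.1) ∨ Sol 0 := by
  intro Sol
  by_contra hn
  simp only [Sol, not_or, not_and, not_not, true_imp_iff, not_le] at hn
  obtain ⟨⟨-, hx₁, hx₂⟩, ⟨-, hy, -⟩, ⟨-, hS0, hV0⟩, -⟩ := hn
  obtain ⟨x, t⟩ := u
  dsimp only at hx₁ hx₂ hy
  by_cases hu : OnSubdivision S P V (x, t)
  swap
  · have h₁ : subdivSucc S P V (x, t) = (x, t) := if_neg hu
    have h₂ : subdivPred S P V (x, t) = (x, t) := if_neg hu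
    have h₃ : subdivMeter S P V (x, t) = 0 := if_neg hu
    rw [h₁, h₂, h₃] at h
    simp only [ne_eq, not_true_eq_false, zero_ne_one, and_false, lt_irrefl, false_and,
      or_false, not_lt_zero] at h
    exact hu (.inl h.1)
  have hroot : OnSubdivision S P V (0, 0) := .inl rfl
  have hSx : S x ≠ x := by
    rcases hu with hu | hu
    · obtain rfl : x = 0 := congrArg Prod.fst hu
      exact hS0
    · exact hu.2.2.1
  have hVx := hx₂ hSx hx₁
  rw [Fin.lt_def] at hVx
  have hgood : GoodEdge S P V x := ⟨hSx, hx₁, hVx⟩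
  have ht0 : (t : ℕ) = 0 → x = 0 ∧ t = 0 := fun h0 => by
    rcases hu with hu | hu
    · exact Prod.mk.inj hu
    · exact absurd (Fin.ext h0) hu.1
  have ht0' : (t : ℕ) = 0 → (V x : ℕ) = 0 := fun h0 => by
    rw [(ht0 h0).1, hV0]
    rfl
  have htV : (t : ℕ) ≤ V x := by
    rcases Nat.eq_zero_or_pos (t : ℕ) with h0 | h0
    · omega
    · rcases hu with hu | hu
      · rw [(Prod.mk.inj hu).2] at h0
        exact absurd h0 (by simp)
      · exact hu.2.1
  have htp : (t : ℕ) ≠ 0 → HasPred S P V x → (V (P x) : ℕ) < t := fun h0 => by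
    rcases hu with hu | hu
    · rw [(Prod.mk.inj hu).2] at h0
      exact absurd rfl h0
    · exact hu.2.2.2
  have hVSx := (V (S x)).2
  have hval : ∀ {k}, k < N → ((Fin.ofNat N k : Fin N) : ℕ) = k := fun hk => Nat.mod_eq_of_lt hk
  have hup : ((Fin.ofNat N (t + 1) : Fin N) : ℕ) = t + 1 := hval (by omega)
  have hup0 : (Fin.ofNat N (t + 1) : Fin N) ≠ 0 := fun h0 => by
    have := congrArg Fin.val h0
    rw [hup] at this
    exact absurd this (by simp)
  have hm : subdivMeter S P V (x, t) = t + 1 := if_pos hu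
  have hsucc : subdivPred S P V (subdivSucc S P V (x, t)) = (x, t) ∧
      subdivMeter S P V (subdivSucc S P V (x, t)) = t + 1 + 1 := by
    by_cases hlt : (t : ℕ) < V x
    · have h₁ : subdivSucc S P V (x, t) = (x, Fin.ofNat N (t + 1)) := by
        rw [subdivSucc, if_pos hu, if_pos hlt]
      have ht : (t : ℕ) ≠ 0 := fun h0 => by have := ht0' h0; omega
      have h₂ : OnSubdivision S P V (x, Fin.ofNat N (t + 1)) :=
        .inr ⟨hup0, by rw [hup]; exact hlt, hSx, fun hp => by
          have := htp ht hp
          rw [hup]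
          dsimp only
          omega⟩
      rw [h₁, subdivMeter, if_pos h₂, subdivPred, if_pos h₂]
      dsimp only
      rw [hup, if_neg (by omega), if_neg]
      · exact ⟨Prod.ext rfl (Fin.ext (hval (by omega))), rfl⟩
      · rintro ⟨hp, he⟩
        have := htp ht hp
        omega
    -- Now `t = V x`, and the step crosses to the subdivision of the edge from `x` to `S x`. Since
    -- `S x` is not a solution, it has a successor other than itself and its own nodes count as
    -- being on a line.
    · have h₁ : subdivSucc S P V (x, t) = (S x, Fin.ofNat N (t + 1)) := by
        rw [subdivSucc, if_pos hu, if_neg hlt]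
      have h₂ : OnSubdivision S P V (S x, Fin.ofNat N (t + 1)) := by
        refine .inr ⟨hup0, by rw [hup]; dsimp only; omega, fun h0 => hSx ?_, fun _ => ?_⟩
        · dsimp only at h0
          rw [h0, hx₁] at hy
          exact hy.symm
        · rw [hup]
          dsimp only
          rw [hx₁]
          omega
      rw [h₁, subdivMeter, if_pos h₂, subdivPred, if_pos h₂]
      dsimp only
      rw [hup, hx₁]
      refine ⟨?_, rfl⟩
      by_cases ht : (t : ℕ) = 0
      · rw [if_pos (by omega), (ht0 ht).1, (ht0 ht).2]
      · rw [if_neg (by omega), if_pos]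
        · exact Prod.ext rfl (Fin.ext (hval (by omega)))
        · refine ⟨⟨?_, by rw [hx₁]⟩, by omega⟩
          rw [hx₁]
          exact hgood
  rcases h with ⟨h, h'⟩ | h | ⟨h, h'⟩ | ⟨-, h⟩ | ⟨h₁, h₂⟩
  · rw [h] at hsucc hm
    rcases h' with h' | h' | h'
    · exact h' (by rw [subdivPred, if_pos hroot, if_pos (by simp)])
    · rw [h', hm] at hsucc
      omega
    · refine h' (hm.trans ?_)
      rw [(Prod.mk.inj h).2]
      rfl
  · exact h hsucc.1
  · rw [hm] at h'
    exact h (Prod.ext (ht0 (by omega)).1 (ht0 (by omega)).2)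
  · rw [hm] at h
    exact h hsucc.2
  · rw [hm] at h₁ h₂
    refine h₂ ?_
    have ht : (t : ℕ) ≠ 0 := by omega
    have hu' : t ≠ 0 ∧ (t : ℕ) ≤ V x ∧ S x ≠ x ∧ (HasPred S P V x → (V (P x) : ℕ) < t) :=
      ⟨fun h0 => ht (by rw [h0]; rfl), htV, hSx, htp ht⟩
    have hdn : ((Fin.ofNat N (t - 1) : Fin N) : ℕ) = t - 1 := hval (by omega)
    rw [subdivPred, if_pos hu]
    dsimp only
    split_ifs with h₃ h₄
    -- Here `t = 1`: the declared predecessor is the root, whose meter is `1`, even if the line does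
    -- not come from there.
    · rw [subdivMeter, if_pos hroot]
      simp
      omega
    · have hdn0 : (Fin.ofNat N (t - 1) : Fin N) ≠ 0 := fun h0 => by
        have := congrArg Fin.val h0
        rw [hdn] at this
        simp at this
        omega
      have : OnSubdivision S P V (P x, Fin.ofNat N (t - 1)) := by
        refine .inr ⟨hdn0, by rw [hdn]; exact h₄.2.ge, h₄.1.1.1, fun hp => ?_⟩
        rw [hdn, ← h₄.2]
        have := hp.1.2.2
        rw [hp.2] at this
        exact this
      rw [subdivMeter, if_pos this]
      dsimp only
      rw [hdn]
      omega
    · have hdn0 : (Fin.ofNat N (t - 1) : Fin N) ≠ 0 := fun h0 => by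
        have := congrArg Fin.val h0
        rw [hdn] at this
        simp at this
        omega
      have : OnSubdivision S P V (x, Fin.ofNat N (t - 1)) := by
        refine .inr ⟨hdn0, by rw [hdn]; dsimp only; omega, hSx, fun hp => ?_⟩
        have h₅ := htp ht hp
        have h₆ : (V (P x) : ℕ) ≠ t - 1 := fun he => h₄ ⟨hp, he⟩
        rw [hdn]
        dsimp only
        omega
      rw [subdivMeter, if_pos this]
      dsimp only
      rw [hdn]
      omega

end Subdivision

theorem sinkOfPotentialLine_reduces_sinkOfMeteredLine :
    SinkOfPotentialLine ≤dt SinkOfMeteredLine := by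
  refine reduces_iff.2 ⟨10000, 1, fun N : ℕ+ => ⟨N * N, 100 * entry N, ?_, ?_⟩⟩
  · let X := ((SinkOfPotentialLine.prob N).Var → Bool)
    let S (x : X) : Fin N → Fin N := readTable fun i => x (Sum.inl i)
    let P (x : X) : Fin N → Fin N := readTable fun i => x (Sum.inr (Sum.inl i))
    let V (x : X) : Fin N → Fin N := readTable fun i => x (Sum.inr (Sum.inr i))
    have hS : ∀ {a} {g : X → Fin N}, Comp a g → Comp (a + entry N) fun x => S x (g x) :=
      fun hg => hg.read.mono (by unfold entry; omega)
    have hP : ∀ {a} {g : X → Fin N}, Comp a g → Comp (a + entry N) fun x => P x (g x) :=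
      fun hg => hg.read.mono (by unfold entry; omega)
    have hV : ∀ {a} {g : X → Fin N}, Comp a g → Comp (a + entry N) fun x => V x (g x) :=
      fun hg => hg.read.mono (by unfold entry; omega)
    have hpred : ∀ y : Fin N, Comp (14 * entry N) fun x => HasPred (S x) (P x) (V x) y := by
      intro y
      unfold HasPred GoodEdge
      apply Comp.mono
      · repeat' first
          | exact Comp.const _ | apply hS | apply hP | apply hV | apply Comp.and | apply Comp.eq
          | apply Comp.ne | apply Comp.lt | apply Comp.val
      · omega
    have hon : ∀ u : Fin N × Fin N, Comp (20 * entry N)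
        fun x => OnSubdivision (S x) (P x) (V x) u := by
      intro u
      unfold OnSubdivision
      apply Comp.mono
      · repeat' first
          | exact Comp.const _ | exact hpred _ | apply hS | apply hP | apply hV | apply Comp.or
          | apply Comp.and | apply Comp.ne | apply Comp.imp | apply Comp.lt | apply Comp.le
          | apply Comp.val
      · omega
    refine red_sinkOfMeteredLine (N * N) (by simp) ((0, 0) : Fin N × Fin N)
      (fun x => subdivSucc (S x) (P x) (V x)) (fun x => subdivPred (S x) (P x) (V x))
      (fun x => subdivMeter (S x) (P x) (V x)) (fun x u => ?_) (fun ⟨y, t⟩ => ?_)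
      (fun ⟨y, t⟩ => ?_) (fun ⟨y, t⟩ => ?_) (fun ⟨y, t⟩ => ?_)
    · have h₁ := u.2.2
      have h₂ : (N : ℕ) ≤ N * N := Nat.le_mul_of_pos_right _ N.pos
      rw [PNat.mul_coe]
      unfold subdivMeter
      split_ifs <;> omega
    · unfold subdivSucc
      apply Comp.mono
      · repeat' first
          | exact Comp.const _ | exact hon _ | apply Comp.ite | apply hS | apply hV
          | apply Comp.pair | apply Comp.lt | apply Comp.val
      · simp; omega
    · unfold subdivPred
      apply Comp.mono
      · repeat' first
          | exact Comp.const _ | exact hon _ | exact hpred _ | apply Comp.ite | apply hP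
          | apply hV | apply Comp.pair | apply Comp.and | apply Comp.eq | apply Comp.val
      · simp; omega
    · unfold subdivMeter
      exact ((hon (y, t)).ite (Comp.const _) (Comp.const _)).mono (by simp)
    · have hv := verifiable_sinkOfPotentialLine N
      refine ((Solves.of_out y).or hv ((Solves.of_comp (hS (Comp.const y))).or hv
        (Solves.of_out (0 : Fin N)))).mono (e := 100 * entry N) (by omega) |>.imp fun x hx => ?_
      exact subdiv_solution (S x) (P x) (V x) (y, t) hx
  · have h₁ := log_size_sinkOfMeteredLine (N * N)
    have h₂ := entry_sinkOfPotentialLine N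
    have h₃ : Nat.clog 2 ((N * N : ℕ+) + 1) ≤ 2 * entry N := by
      have h₄ := Nat.le_pow_clog one_lt_two (N : ℕ)
      refine Nat.clog_le_of_le_pow ?_
      have h₅ : (N * N : ℕ) ≤ 2 ^ Nat.clog 2 N * 2 ^ Nat.clog 2 N := Nat.mul_le_mul h₄ h₄
      have h₆ : 0 < 2 ^ Nat.clog 2 N * 2 ^ Nat.clog 2 N := by positivity
      rw [PNat.mul_coe, two_mul, pow_add, pow_succ]
      nlinarith
    rw [pow_one]
    omega

/-! ### `Empty-Child-with-Height` reduces to `Lossy-Code`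

The nodes below the root are compared with the paths of length `⌈log₂ N⌉ + 1`. -/

section Walk

/-- The binary encoding of the path of length `k` that leads to a node. -/
def pathTo {N : ℕ} (F R : Fin N → Fin N) : ℕ → Fin N → ℕ
  | 0, _ => 0
  | k + 1, w => 2 * pathTo F R k (F w) + if w = R (F w) then 1 else 0

theorem pathTo_lt {N : ℕ} (F R : Fin N → Fin N) (k : ℕ) (w : Fin N) : pathTo F R k w < 2 ^ k := by
  induction k generalizing w with
  | zero => simp [pathTo]
  | succ k ih =>
    have := ih (F w)
    rw [pathTo, pow_succ]
    split_ifs <;> omega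

variable {N : ℕ} [NeZero N]

/-- The node reached from the root by the path of length `k` with binary encoding `p`. -/
def walk (L R : Fin N → Fin N) : ℕ → ℕ → Fin N
  | 0, _ => 0
  | k + 1, p => if p % 2 = 0 then L (walk L R k (p / 2)) else R (walk L R k (p / 2))

/-- Some node on the path `p` is an empty child or a wrong root. -/
def BadOnPath (F L R : Fin N → Fin N) : ℕ → ℕ → Prop
  | 0, _ => EmptyChildAt F L R 0 ∨ WrongRootAt F L R 0
  | k + 1, p => (EmptyChildAt F L R (walk L R (k + 1) p) ∨
      WrongRootAt F L R (walk L R (k + 1) p)) ∨ BadOnPath F L R k (p / 2)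

theorem BadOnPath.root {F L R : Fin N → Fin N} {k p : ℕ} (h : BadOnPath F L R 0 0) :
    BadOnPath F L R k p := by
  induction k generalizing p with
  | zero => exact h
  | succ k ih => exact .inr ih

/-- Without a defect on the path, climbing by `F` retraces it and each bit is read off from whether
the node is the right child. The second conclusion strengthens the induction: nodes with `F v = L v
= R v = v` are legal isolated nodes, and the walk must be kept from falling into one. -/
theorem pathTo_walk {F L R : Fin N → Fin N} {k p : ℕ} (hp : p < 2 ^ k)
    (h : ¬ BadOnPath F L R k p) :
    pathTo F R k (walk L R k p) = p ∧ (walk L R k p = 0 ∨ F (walk L R k p) ≠ walk L R k p) := by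
  induction k generalizing p with
  | zero =>
    obtain rfl : p = 0 := by simpa using hp
    exact ⟨rfl, .inl rfl⟩
  | succ k ih =>
    have hbad : ¬ (EmptyChildAt F L R (walk L R k (p / 2)) ∨ WrongRootAt F L R 0) := by
      rintro (hb | hb)
      · refine h (.inr ?_)
        cases k with
        | zero => exact .inl hb
        | succ k => exact .inl (.inl hb)
      · exact h (BadOnPath.root (.inr hb))
    obtain ⟨ih₁, ih₂⟩ := ih (by rw [pow_succ] at hp; omega) fun hb => h (.inr hb)
    simp only [walk, pathTo]
    obtain ⟨v, hv⟩ : ∃ v, walk L R k (p / 2) = v := ⟨_, rfl⟩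
    simp only [hv] at hbad ih₁ ih₂ ⊢
    simp only [EmptyChildAt, WrongRootAt, not_or, not_and, not_not, true_imp_iff] at hbad
    obtain ⟨⟨hL, hR, hLR⟩, hL0, hR0, -⟩ := hbad
    have hfix : F v = v → v = 0 := fun hv => ih₂.resolve_right (not_not_intro hv)
    -- A self-loop `L v = v` makes `v` its own father, so `v` is the root, where such a loop is a
    -- wrong root.
    have hLv : L v ≠ v := fun he => by
      rw [he] at hL
      have := hfix hL
      subst this
      exact hL0 he
    have hRv : R v ≠ v := fun he => by
      rw [he] at hR
      have := hfix hR
      subst this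
      exact hR0 he
    have hne : L v ≠ R v := fun he => hRv (hLR he)
    split_ifs with h₀ h₁ h₁
    · rw [hL] at h₁
      exact absurd h₁ hne
    · rw [hL, ih₁]
      exact ⟨by omega, .inr hLv.symm⟩
    · rw [hR, ih₁]
      exact ⟨by omega, .inr hRv.symm⟩
    · rw [hR] at h₁
      exact absurd rfl h₁

end Walk

/-- Rounding `N` up to a power of two `M` makes `[2M]` exactly the set of paths of length `q`. The
depth is cubic in `q` because each node on a path of length `q` is recomputed from the root before
it is tested, by up to `q` reads of up to `q` bits. -/
theorem emptyChildHeight_reduces_lossyCode : EmptyChildHeight ≤dt LossyCode := by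
  refine reduces_iff.2 ⟨2700, 3, fun N : ℕ+ => ?_⟩
  obtain ⟨q, hq⟩ : ∃ q, q = entry N := ⟨_, rfl⟩
  let M : ℕ+ := ⟨2 ^ Nat.clog 2 N, by positivity⟩
  have hM : ((2 * M : ℕ+) : ℕ) = 2 ^ q := by
    rw [hq, pow_succ, mul_comm]
    rfl
  have hNM : (N : ℕ) ≤ M := Nat.le_pow_clog one_lt_two _
  have hq1 : 1 ≤ q := by rw [hq]; exact Nat.succ_pos _
  have hq2 : q ≤ q * q := Nat.le_mul_of_pos_right _ hq1
  have hq3 : q * q ≤ q * q * q := Nat.le_mul_of_pos_right _ hq1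
  refine ⟨M, 40 * (q * q * q), ?_, ?_⟩
  · let X := ((EmptyChildHeight.prob N).Var → Bool)
    let F (x : X) : Fin N → Fin N := readTable fun i => x (Sum.inl (Sum.inl i))
    let L (x : X) : Fin N → Fin N := readTable fun i => x (Sum.inl (Sum.inr i))
    let R (x : X) : Fin N → Fin N := readTable fun i => x (Sum.inr (Sum.inl i))
    have hF : ∀ {a} {g : X → Fin N}, Comp a g → Comp (a + q) fun x => F x (g x) :=
      fun hg => hg.read.mono (by rw [hq]; unfold entry; omega)
    have hL : ∀ {a} {g : X → Fin N}, Comp a g → Comp (a + q) fun x => L x (g x) :=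
      fun hg => hg.read.mono (by rw [hq]; unfold entry; omega)
    have hR : ∀ {a} {g : X → Fin N}, Comp a g → Comp (a + q) fun x => R x (g x) :=
      fun hg => hg.read.mono (by rw [hq]; unfold entry; omega)
    have hwalk : ∀ k p, Comp (k * q) fun x => walk (L x) (R x) k p := by
      intro k
      induction k with
      | zero => exact fun p => (Comp.const _).mono (by omega)
      | succ k ih =>
        intro p
        rw [add_mul, one_mul]
        unfold walk
        split_ifs
        · exact hL (ih _)
        · exact hR (ih _)
    have hpath : ∀ k w, Comp (k * (2 * q)) fun x => pathTo (F x) (R x) k w := by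
      intro k
      induction k with
      | zero => exact fun p => (Comp.const _).mono (by omega)
      | succ k ih =>
        intro w
        unfold pathTo
        have : ∀ y, Comp (k * (2 * q) + q) fun x => 2 * pathTo (F x) (R x) k y +
            if w = R x y then 1 else 0 := fun y =>
          (((ih y).map fun m => 2 * m).add (((Comp.const w).eq (hR (Comp.const y))).ite
            (Comp.const 1) (Comp.const 0))).mono (by simp)
        exact ((hF (Comp.const w)).bind this).mono (by rw [add_mul]; omega)
    have hv := verifiable_emptyChildHeight N
    rw [← hq] at hv
    have hsol : ∀ x v, EmptyChildAt (F x) (L x) (R x) v ∨ WrongRootAt (F x) (L x) (R x) v →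
        (EmptyChildHeight.prob N).Sol x v := by
      rintro x v (h | h)
      · exact .inl h
      · exact .inr (.inl h)
    have hbad : ∀ k p, k ≤ q → Solves (k * (2 * (q * q) + 30 * q)) (EmptyChildHeight.prob N)
        fun x => BadOnPath (F x) (L x) (R x) k p := by
      intro k
      induction k with
      | zero =>
        exact fun p _ => ((Solves.of_out (R := EmptyChildHeight.prob N) (0 : Fin N)).imp
          fun x hx => hsol x 0 hx).mono (by omega)
      | succ k ih =>
        intro p hk
        have h₁ : (k + 1) * q ≤ q * q := Nat.mul_le_mul_right _ hk
        refine (((Solves.of_comp (R := EmptyChildHeight.prob N) (hwalk (k + 1) p)).imp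
          fun x hx => hsol x _ hx).or hv (ih (p / 2) (by omega))).mono ?_
        rw [add_mul k 1 (2 * (q * q) + 30 * q)]
        omega
    -- Elements of `[M]` beyond `N` are not nodes and are never endpoints of a walk, so the default
    -- value `0` does not matter.
    refine ⟨fun x => Sum.elim
      (writeTable fun a => if h : (a : ℕ) < N then
        ⟨pathTo (F x) (R x) q ⟨a, h⟩, (pathTo_lt ..).trans_eq hM.symm⟩ else 0)
      (writeTable fun p => Fin.castLE hNM (walk (L x) (R x) q p)), ?_,
      fun (p : Fin (2 * M : ℕ+)) => ?_⟩
    · rintro (i | i)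
      · refine Comp.writeTable (φ := fun x a => if h : (a : ℕ) < N then
          ⟨pathTo (F x) (R x) q ⟨a, h⟩, (pathTo_lt ..).trans_eq hM.symm⟩ else 0) (fun a => ?_) i
        split_ifs
        · refine ((hpath q _).fin_mk _).mono ?_
          rw [mul_left_comm]
          omega
        · exact (Comp.const _).mono (by omega)
      · exact Comp.writeTable (fun p => ((hwalk q p).map (Fin.castLE hNM)).mono (by omega)) i
    · refine (hbad q p le_rfl).mono ?_ |>.imp fun x hx => ?_
      · rw [mul_add, mul_left_comm, mul_left_comm q 30, ← mul_assoc q q]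
        omega
      · by_contra hb
        refine hx ?_
        have hp : (p : ℕ) < 2 ^ q := p.2.trans_eq hM
        simp only [Sum.elim_inl, Sum.elim_inr, readTable_writeTable]
        apply Fin.ext
        simpa using (pathTo_walk hp hb).1
  · have h₁ := log_size_lossyCode M
    have h₂ : Nat.clog 2 (2 * M) = q := by
      rw [show 2 * (M : ℕ) = 2 ^ q from hM]
      exact Nat.clog_pow 2 q one_lt_two
    have h₃ := entry_emptyChildHeight N
    rw [← hq] at h₃
    have h₄ : q * q * q ≤ (3 * (Nat.log 2 (EmptyChildHeight.prob N).size + 1)) ^ 3 := by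
      rw [pow_succ, pow_two]
      exact Nat.mul_le_mul (Nat.mul_le_mul h₃ h₃) h₃
    rw [mul_pow] at h₄
    omega

/-! ### The layers of the tree

If `f : [N] → [2N]` and `g : [2N] → [N]` are inverse to each other, then `[m]` and `[m - N]` are
in bijection for every `m ≥ 2N`. Starting from one node, doubling, and shrinking in this way, one
gets layers with less than `2N` nodes. -/

/-- The size of `[m]` after replacing the last `2N` elements by `N` elements. -/
def shrinkSize (N m : ℕ) : ℕ := if m < 2 * N then m else m - N

/-- The position of an element of `[m]` among the last `2N`, or of an element of
`[m - N]` among the last `N`. -/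
def offset (N m z : ℕ) : ℕ := z - (m - 2 * N)

/-- The map from `[m]` to `[shrinkSize N m]` given by `g : [2N] → [N]`. The same formula gives
the map from `[shrinkSize N m]` to `[m]` for `f : [N] → [2N]`. -/
def reblock (N : ℕ) (g : ℕ → ℕ) (m z : ℕ) : ℕ :=
  if m < 2 * N ∨ z < m - 2 * N then z else m - 2 * N + g (offset N m z)

/-- The number of nodes in a layer. -/
def width (N : ℕ) : ℕ → ℕ
  | 0 => 1
  | k + 1 => shrinkSize N (shrinkSize N (2 * width N k))

/-- The map from the children of layer `k` to layer `k + 1`. -/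
def layerDown (N : ℕ) (g : ℕ → ℕ) (k z : ℕ) : ℕ :=
  reblock N g (shrinkSize N (2 * width N k)) (reblock N g (2 * width N k) z)

/-- The map from layer `k + 1` to the children of layer `k`. -/
def layerUp (N : ℕ) (f : ℕ → ℕ) (k z : ℕ) : ℕ :=
  reblock N f (2 * width N k) (reblock N f (shrinkSize N (2 * width N k)) z)

section Layers

variable {N : ℕ} {f g : ℕ → ℕ}

theorem reblock_lt_shrinkSize (hg : ∀ w, g w < N) {m z : ℕ} (hz : z < m) :
    reblock N g m z < shrinkSize N m := by
  have := hg (offset N m z)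
  unfold reblock shrinkSize
  split_ifs <;> omega

theorem reblock_lt (hf : ∀ a, f a < 2 * N) {m z : ℕ} (hz : z < shrinkSize N m) :
    reblock N f m z < m := by
  have := hf (offset N m z)
  unfold reblock
  unfold shrinkSize at hz
  split_ifs at * <;> omega

/-- Both maps fix the initial segment below `m - 2 * N` and act on offsets above it. Nothing
distinguishes `f` from `g`, so the same statement serves for the other composition. -/
theorem reblock_reblock {m z : ℕ} (h : f (g (offset N m z)) = offset N m z) :
    reblock N f m (reblock N g m z) = z := by
  unfold reblock
  by_cases hc : m < 2 * N ∨ z < m - 2 * N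
  · rw [if_pos hc, if_pos hc]
  · rw [if_neg hc, if_neg (by omega)]
    have : offset N m (m - 2 * N + g (offset N m z)) = g (offset N m z) := by
      rw [offset]
      omega
    rw [this, h]
    unfold offset
    omega

theorem reblock_reblock' {m z : ℕ}
    (h : 2 * N ≤ m → g (f (offset N m z)) = offset N m z) :
    reblock N g m (reblock N f m z) = z := by
  by_cases hm : 2 * N ≤ m
  · exact reblock_reblock (h hm)
  · unfold reblock
    rw [if_pos (by omega), if_pos (by omega)]

theorem width_pos (hN : 0 < N) (k : ℕ) : 0 < width N k := by
  induction k with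
  | zero => exact Nat.one_pos
  | succ k ih =>
    unfold width shrinkSize
    split_ifs <;> omega

/-- This is why a layer is shrunk twice: doubling stays below `4 * N`, and each shrinking of a set
of size at least `2 * N` removes `N` elements. -/
theorem width_lt (hN : 0 < N) (k : ℕ) : width N k < 2 * N := by
  induction k with
  | zero => unfold width; omega
  | succ k ih =>
    unfold width shrinkSize
    split_ifs <;> omega

theorem layerDown_lt (hg : ∀ w, g w < N) {k z : ℕ} (hz : z < 2 * width N k) :
    layerDown N g k z < width N (k + 1) :=
  reblock_lt_shrinkSize hg (reblock_lt_shrinkSize hg hz)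

theorem layerUp_lt (hf : ∀ a, f a < 2 * N) {k z : ℕ} (hz : z < width N (k + 1)) :
    layerUp N f k z < 2 * width N k :=
  reblock_lt hf (reblock_lt hf hz)

/-- The arguments of `g` in the computation of `layerDown`. -/
def downQuery₁ (N k z : ℕ) : ℕ := offset N (2 * width N k) z

/-- The arguments of `g` in the computation of `layerDown`. -/
def downQuery₂ (N : ℕ) (g : ℕ → ℕ) (k z : ℕ) : ℕ :=
  offset N (shrinkSize N (2 * width N k)) (reblock N g (2 * width N k) z)

/-- The arguments of `f` in the computation of `layerUp`. -/
def upQuery₁ (N k z : ℕ) : ℕ := offset N (shrinkSize N (2 * width N k)) z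

/-- The arguments of `f` in the computation of `layerUp`. -/
def upQuery₂ (N : ℕ) (f : ℕ → ℕ) (k z : ℕ) : ℕ :=
  offset N (2 * width N k) (reblock N f (shrinkSize N (2 * width N k)) z)

theorem offset_lt_of_lt {m z : ℕ} (hN : 0 < N) (hz : z < m) : offset N m z < 2 * N := by
  unfold offset
  omega

theorem offset_lt_of_lt_shrinkSize {m z : ℕ} (hm : 2 * N ≤ m) (hN : 0 < N)
    (hz : z < shrinkSize N m) : offset N m z < N := by
  unfold offset
  unfold shrinkSize at hz
  split_ifs at hz <;> omega

/-- Each of the two shrinkings evaluates `g` at most once, so a failed round trip is charged to one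
of two explicit arguments, each a possible solution of the lossy code. -/
theorem layerUp_layerDown (hN : 0 < N) (hg : ∀ w, g w < N) {k z : ℕ} (hz : z < 2 * width N k)
    (h : layerUp N f k (layerDown N g k z) ≠ z) :
    ∃ w < 2 * N, f (g w) ≠ w ∧ (w = downQuery₁ N k z ∨ w = downQuery₂ N g k z) := by
  by_contra! hn
  have h₁ : f (g (downQuery₁ N k z)) = downQuery₁ N k z := by
    by_contra hne
    exact (hn _ (offset_lt_of_lt hN hz) hne).1 rfl
  have h₂ : f (g (downQuery₂ N g k z)) = downQuery₂ N g k z := by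
    by_contra hne
    exact (hn _ (offset_lt_of_lt hN (reblock_lt_shrinkSize hg hz)) hne).2 rfl
  exact h (by rw [layerUp, layerDown, reblock_reblock h₂, reblock_reblock h₁])

theorem layerDown_layerUp (hN : 0 < N) (hf : ∀ a, f a < 2 * N) {k z : ℕ}
    (hz : z < width N (k + 1)) (h : layerDown N g k (layerUp N f k z) ≠ z) :
    ∃ a < N, g (f a) ≠ a ∧ (a = upQuery₁ N k z ∨ a = upQuery₂ N f k z) := by
  by_contra! hn
  -- Sets smaller than `2 * N` are left unchanged; the offset then need not be below `N`, and no
  -- condition on it is available or required.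
  have h₁ : 2 * N ≤ shrinkSize N (2 * width N k) →
      g (f (upQuery₁ N k z)) = upQuery₁ N k z := fun hm => by
    by_contra hne
    exact (hn _ (offset_lt_of_lt_shrinkSize hm hN hz) hne).1 rfl
  have h₂ : 2 * N ≤ 2 * width N k → g (f (upQuery₂ N f k z)) = upQuery₂ N f k z := fun hm => by
    by_contra hne
    exact (hn _ (offset_lt_of_lt_shrinkSize hm hN (reblock_lt hf hz)) hne).2 rfl
  exact h (by rw [layerUp, layerDown, reblock_reblock' h₂, reblock_reblock' h₁])

end Layers

/-! ### The tree along a metered line -/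

section LineTree

variable {m N : ℕ} [NeZero N]

/-- The nodes of the tree: the vertices `x` of the line with one layer for each. -/
abbrev TreeNode (m N : ℕ) : Type := Fin m × Fin (2 * N)

/-- `u` is a node of the tree. -/
def InTree (V : Fin m → ℕ) (u : TreeNode m N) : Prop :=
  1 ≤ V u.1 ∧ (u.2 : ℕ) < width N (V u.1 - 1)

open Classical in
/-- The child number `b` of a node. -/
noncomputable def treeChild (S : Fin m → Fin m) (V : Fin m → ℕ) (g : ℕ → ℕ) (b : ℕ)
    (u : TreeNode m N) : TreeNode m N :=
  if InTree V u then
    (S u.1, Fin.ofNat (2 * N) (layerDown N g (V u.1 - 1) (2 * u.2 + b))) else u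

open Classical in
/-- The father of a node. -/
noncomputable def treeFather (P : Fin m → Fin m) (V : Fin m → ℕ) (f : ℕ → ℕ)
    (u : TreeNode m N) : TreeNode m N :=
  if InTree V u ∧ 2 ≤ V u.1 then
    (P u.1, Fin.ofNat (2 * N) (layerUp N f (V u.1 - 2) u.2 / 2)) else u

variable {S P : Fin m → Fin m} {V : Fin m → ℕ} {f g : ℕ → ℕ} {u : TreeNode m N}

theorem treeChild_of_not_inTree {b : ℕ} (hu : ¬ InTree V u) : treeChild S V g b u = u :=
  if_neg hu

theorem inTree_treeChild (hg : ∀ w, g w < N) {b : ℕ} (hb : b < 2) (hu : InTree V u)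
    (hV : V (S u.1) = V u.1 + 1) :
    InTree V (treeChild S V g b u) ∧ (treeChild S V g b u).1 = S u.1 ∧
      ((treeChild S V g b u).2 : ℕ) = layerDown N g (V u.1 - 1) (2 * u.2 + b) := by
  obtain ⟨h₁, h₂⟩ := id hu
  have hlt : layerDown N g (V u.1 - 1) (2 * u.2 + b) < width N (V u.1) := by
    have := layerDown_lt hg (k := V u.1 - 1) (z := 2 * u.2 + b) (by omega)
    rwa [Nat.sub_add_cancel h₁] at this
  have hval : ((Fin.ofNat (2 * N) (layerDown N g (V u.1 - 1) (2 * u.2 + b)) : Fin (2 * N)) : ℕ) =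
      layerDown N g (V u.1 - 1) (2 * u.2 + b) :=
    Nat.mod_eq_of_lt (hlt.trans (width_lt (NeZero.pos N) _))
  rw [treeChild, if_pos hu]
  refine ⟨⟨?_, ?_⟩, rfl, hval⟩
  · dsimp only
    omega
  · dsimp only
    rw [hval, hV]
    exact hlt

theorem treeFather_treeChild (hg : ∀ w, g w < N) {b : ℕ} (hb : b < 2) (hu : InTree V u)
    (hV : V (S u.1) = V u.1 + 1) (hPS : P (S u.1) = u.1)
    (hup : layerUp N f (V u.1 - 1) (layerDown N g (V u.1 - 1) (2 * u.2 + b)) = 2 * u.2 + b) :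
    treeFather P V f (treeChild S V g b u) = u := by
  obtain ⟨h₁, h₂, h₃⟩ := inTree_treeChild hg hb hu hV
  rw [treeFather, if_pos ⟨h₁, by rw [h₂, hV]; have := hu.1; omega⟩, h₂, h₃, hPS, hV,
    show V u.1 + 1 - 2 = V u.1 - 1 by omega, hup]
  refine Prod.ext rfl (Fin.ext ?_)
  have := u.2.2
  refine (Nat.mod_eq_of_lt ?_).trans ?_ <;> omega

theorem inTree_treeFather (hf : ∀ a, f a < 2 * N) (hu : InTree V u) (h2 : 2 ≤ V u.1)
    (hV : V u.1 = V (P u.1) + 1) :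
    InTree V (treeFather P V f u) ∧ (treeFather P V f u).1 = P u.1 ∧
      ((treeFather P V f u).2 : ℕ) = layerUp N f (V u.1 - 2) u.2 / 2 := by
  have hlt : layerUp N f (V u.1 - 2) u.2 < 2 * width N (V u.1 - 2) := by
    refine layerUp_lt hf ?_
    rw [show V u.1 - 2 + 1 = V u.1 - 1 by omega]
    exact hu.2
  have hw := width_lt (NeZero.pos N) (V u.1 - 2)
  have hval : ((Fin.ofNat (2 * N) (layerUp N f (V u.1 - 2) u.2 / 2) : Fin (2 * N)) : ℕ) =
      layerUp N f (V u.1 - 2) u.2 / 2 := Nat.mod_eq_of_lt (by omega)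
  rw [treeFather, if_pos ⟨hu, h2⟩]
  refine ⟨⟨?_, ?_⟩, rfl, hval⟩
  · dsimp only
    omega
  · dsimp only
    rw [hval, show V (P u.1) - 1 = V u.1 - 2 by omega]
    omega

theorem treeChild_treeFather (hf : ∀ a, f a < 2 * N) (hu : InTree V u) (h2 : 2 ≤ V u.1)
    (hV : V u.1 = V (P u.1) + 1) (hSP : S (P u.1) = u.1)
    (hdown : layerDown N g (V u.1 - 2) (layerUp N f (V u.1 - 2) u.2) = u.2) :
    treeChild S V g (layerUp N f (V u.1 - 2) u.2 % 2) (treeFather P V f u) = u := by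
  obtain ⟨h₁, h₂, h₃⟩ := inTree_treeFather hf hu h2 hV
  rw [treeChild, if_pos h₁, h₂, h₃, hSP, Nat.div_add_mod,
    show V (P u.1) - 1 = V u.1 - 2 by omega, hdown]
  exact Prod.ext rfl (Fin.ext (Nat.mod_eq_of_lt u.2.2))

/-- Some argument of `g` in the computation of the children of `u` witnesses that `g` is not
injective. -/
def BadDown (V : Fin m → ℕ) (f g : ℕ → ℕ) (u : TreeNode m N) : Prop :=
  ∃ w < 2 * N, f (g w) ≠ w ∧
    ((w = downQuery₁ N (V u.1 - 1) (2 * u.2 + 0) ∨ w = downQuery₂ N g (V u.1 - 1) (2 * u.2 + 0)) ∨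
    (w = downQuery₁ N (V u.1 - 1) (2 * u.2 + 1) ∨ w = downQuery₂ N g (V u.1 - 1) (2 * u.2 + 1)))

/-- Some argument of `f` in the computation of the father of `u` witnesses that `f` is not
injective. -/
def BadUp (V : Fin m → ℕ) (f g : ℕ → ℕ) (u : TreeNode m N) : Prop :=
  ∃ a < N, g (f a) ≠ a ∧ (a = upQuery₁ N (V u.1 - 2) u.2 ∨ a = upQuery₂ N f (V u.1 - 2) u.2)

variable [NeZero m]

/-- If the line is correct at `u.1` and `f` undoes `g` at the arguments consulted for the children
of `u`, then both children lie in the next layer and lead back to `u`. Pairs outside the tree are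
self-loops for all three functions and yield no solution. The father lies one step back on the line,
so the height is correct by the meter condition. -/
theorem tree_solution (hg : ∀ w, g w < N)
    (h : (treeFather P V f (treeChild S V g 0 u) ≠ u ∨
        treeFather P V f (treeChild S V g 1 u) ≠ u ∨
        (treeChild S V g 0 u = treeChild S V g 1 u ∧ treeChild S V g 1 u ≠ u)) ∨
      (u = (0, 0) ∧ (treeChild S V g 0 ((0, 0) : TreeNode m N) = (0, 0) ∨
        treeChild S V g 1 ((0, 0) : TreeNode m N) = (0, 0) ∨
        treeFather P V f ((0, 0) : TreeNode m N) ≠ (0, 0))) ∨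
      ((u ≠ (0, 0) ∧ u ≠ treeFather P V f u ∧
        V u.1 - 1 ≠ V (treeFather P V f u).1 - 1 + 1) ∨ (u = (0, 0) ∧ V 0 - 1 ≠ 0))) :
    SinkOfMeteredLineSol S P V u.1 ∨ BadDown V f g u := by
  by_contra hn
  rw [not_or] at hn
  obtain ⟨hs, hb⟩ := hn
  simp only [SinkOfMeteredLineSol, not_or, not_and, not_not] at hs
  obtain ⟨hs₁, hs₂, hs₃, hs₄, hs₅⟩ := hs
  by_cases hu : InTree V u
  · have hV : V (S u.1) = V u.1 + 1 := hs₄ hu.1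
    have hup : ∀ b < 2, layerUp N f (V u.1 - 1) (layerDown N g (V u.1 - 1) (2 * u.2 + b)) =
        2 * u.2 + b := by
      intro b hb2
      by_contra hne
      obtain ⟨w, hw, hfg, hq⟩ := layerUp_layerDown (NeZero.pos N) hg
        (by have := hu.2; omega) hne
      refine hb ⟨w, hw, hfg, ?_⟩
      interval_cases b
      · exact .inl hq
      · exact .inr hq
    have hf₀ := treeFather_treeChild hg (b := 0) (by omega) hu hV hs₂ (hup 0 (by omega))
    have hf₁ := treeFather_treeChild hg (b := 1) (by omega) hu hV hs₂ (hup 1 (by omega))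
    have hc₀ := inTree_treeChild hg (b := 0) (by omega) hu hV
    have hc₁ := inTree_treeChild hg (b := 1) (by omega) hu hV
    rcases h with (h | h | ⟨h, -⟩) | ⟨rfl, h⟩ | ⟨h, h', h''⟩ | ⟨h, h'⟩
    · exact h hf₀
    · exact h hf₁
    -- Equal children would decode to both `2 * u.2` and `2 * u.2 + 1`.
    · have h₀ := hup 0 (by omega)
      have h₁ := hup 1 (by omega)
      rw [← hc₀.2.2, h, hc₁.2.2, h₁] at h₀
      omega
    · obtain ⟨-, hS0, hV0⟩ := hs₁ rfl
      rcases h with h | h | h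
      · rw [h] at hc₀
        exact hS0 hc₀.2.1.symm
      · rw [h] at hc₁
        exact hS0 hc₁.2.1.symm
      · refine h (if_neg ?_)
        dsimp only
        omega
    · by_cases h2 : 2 ≤ V u.1
      · have hVP : V u.1 = V (P u.1) + 1 := hs₅ (by omega)
        rw [treeFather, if_pos ⟨hu, h2⟩] at h''
        dsimp only at h''
        omega
      · exact h' (by rw [treeFather, if_neg fun hc => h2 hc.2])
    · obtain ⟨-, -, hV0⟩ := hs₁ (congrArg Prod.fst h)
      omega
  · have hc : ∀ b, treeChild S V g b u = u := fun b => if_neg hu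
    have hf : treeFather P V f u = u := if_neg fun hc => hu hc.1
    rw [hc, hc, hf] at h
    rcases h with (h | h | ⟨-, h⟩) | ⟨h, -⟩ | ⟨-, h, -⟩ | ⟨h, -⟩
    · exact h rfl
    · exact h rfl
    · exact h rfl
    · subst h
      refine hu ⟨(hs₁ rfl).2.2.ge, ?_⟩
      exact width_pos (NeZero.pos N) _
    · exact h rfl
    · subst h
      refine hu ⟨(hs₁ rfl).2.2.ge, ?_⟩
      exact width_pos (NeZero.pos N) _

/-- Layer `0` has width one and meter `1` occurs only at the source, so any other tree node has a
father one layer up. `S` inverting `P` and `g` inverting `f` then return to the node, and the parity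
of its decoded number tells which child it is. -/
theorem tree_wrongFather (hf : ∀ a, f a < 2 * N) (h₀ : u ≠ (0, 0))
    (hL : u ≠ treeChild S V g 0 (treeFather P V f u))
    (hR : u ≠ treeChild S V g 1 (treeFather P V f u)) :
    EndOfMeteredLineSol S P V u.1 ∨ BadUp V f g u := by
  by_contra hn
  rw [not_or] at hn
  obtain ⟨hs, hb⟩ := hn
  simp only [EndOfMeteredLineSol, SinkOfMeteredLineSol, not_or, not_and, not_not] at hs
  obtain ⟨⟨hs₁, hs₂, hs₃, hs₄, hs₅⟩, hs₆, -⟩ := hs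
  by_cases hu : InTree V u
  · have hne : u.1 = 0 → V u.1 ≠ 1 := fun hx hV => by
      refine h₀ (Prod.ext hx (Fin.ext ?_))
      have := hu.2
      rw [hV] at this
      exact Nat.lt_one_iff.1 this
    have hV1 : V u.1 ≠ 1 := fun hV => by
      by_cases hx : u.1 = 0
      · exact hne hx hV
      · exact hs₃ hx hV
    have h2 : 2 ≤ V u.1 := by
      have := hu.1
      omega
    have hx : u.1 ≠ 0 := fun hx => by
      have := (hs₁ hx).2.2
      rw [← hx] at this
      exact hV1 this
    have hdown : layerDown N g (V u.1 - 2) (layerUp N f (V u.1 - 2) u.2) = u.2 := by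
      by_contra hne
      have hz : (u.2 : ℕ) < width N (V u.1 - 2 + 1) := by
        rw [show V u.1 - 2 + 1 = V u.1 - 1 by omega]
        exact hu.2
      exact hb (layerDown_layerUp (NeZero.pos N) hf hz hne)
    have := treeChild_treeFather hf hu h2 (hs₅ (by omega)) (hs₆ hx) hdown
    rcases Nat.mod_two_eq_zero_or_one (layerUp N f (V u.1 - 2) u.2) with hm | hm <;> rw [hm] at this
    · exact hL this.symm
    · exact hR this.symm
  · have hF : treeFather P V f u = u := if_neg fun hc => hu hc.1
    rw [hF, treeChild_of_not_inTree hu] at hL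
    exact hL rfl

end LineTree

/-! ### Query depth of the tree functions and of the search for a faulty code argument -/

section TreeComp

variable {X : Type} {m N q : ℕ} {S P : (X → Bool) → Fin m → Fin m}
  {V : (X → Bool) → Fin m → ℕ} {f g : (X → Bool) → ℕ → ℕ}

theorem comp_reblock (hg : ∀ w, Comp q fun x => g x w) (M z : ℕ) :
    Comp q fun x => reblock N (g x) M z := by
  unfold reblock
  split_ifs
  · exact (Comp.const _).mono (Nat.zero_le _)
  · exact (hg _).map fun y => M - 2 * N + y

theorem comp_layerDown (hg : ∀ w, Comp q fun x => g x w) (k z : ℕ) :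
    Comp (2 * q) fun x => layerDown N (g x) k z := by
  rw [two_mul]
  exact (comp_reblock hg _ z).bind fun y => comp_reblock hg _ y

theorem comp_layerUp (hf : ∀ a, Comp q fun x => f x a) (k z : ℕ) :
    Comp (2 * q) fun x => layerUp N (f x) k z := by
  rw [two_mul]
  exact (comp_reblock hf _ z).bind fun y => comp_reblock hf _ y

theorem comp_inTree (hV : ∀ v, Comp q fun x => V x v) (u : TreeNode m N) :
    Comp q fun x => InTree (V x) u :=
  (hV u.1).map fun k => 1 ≤ k ∧ (u.2 : ℕ) < width N (k - 1)

theorem Solves.badDown {R : SearchProblem} {V : (R.Var → Bool) → Fin m → ℕ}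
    {f g : (R.Var → Bool) → ℕ → ℕ} {v : ℕ} (hR : Verifiable v R)
    (hV : ∀ a, Comp q fun x => V x a) (hg : ∀ w, Comp q fun x => g x w) (out : ℕ → R.Out)
    (hout : ∀ x, ∀ w < 2 * N, f x (g x w) ≠ w → R.Sol x (out w)) (u : TreeNode m N) :
    Solves (12 * q + 4 * v) R fun x => BadDown (V x) (f x) (g x) u := by
  have h₁ : ∀ z, Comp q fun x => out (downQuery₁ N (V x u.1 - 1) z) := fun z =>
    (hV u.1).map fun k => out (downQuery₁ N (k - 1) z)
  have h₂ : ∀ z, Comp (q + q) fun x => out (downQuery₂ N (g x) (V x u.1 - 1) z) := fun z =>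
    (hV u.1).bind (h := fun k x => out (downQuery₂ N (g x) (k - 1) z)) fun k =>
      (comp_reblock hg _ z).map fun y => out (offset N (shrinkSize N (2 * width N (k - 1))) y)
  -- Four candidates, two per child. Each inner choice costs `4 * q + v`, so the outer one costs `12
  -- * q + 4 * v`.
  refine ((((Solves.of_comp (h₁ (2 * u.2 + 0))).or hR (Solves.of_comp (h₂ (2 * u.2 + 0)))).or hR
    ((Solves.of_comp (h₁ (2 * u.2 + 1))).or hR
      (Solves.of_comp (h₂ (2 * u.2 + 1))))).imp ?_).mono (by omega)
  · rintro x ⟨w, hw, hne, (rfl | rfl) | (rfl | rfl)⟩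
    · exact .inl (.inl (hout x _ hw hne))
    · exact .inl (.inr (hout x _ hw hne))
    · exact .inr (.inl (hout x _ hw hne))
    · exact .inr (.inr (hout x _ hw hne))

theorem Solves.badUp {R : SearchProblem} {V : (R.Var → Bool) → Fin m → ℕ}
    {f g : (R.Var → Bool) → ℕ → ℕ} {v : ℕ} (hR : Verifiable v R)
    (hV : ∀ a, Comp q fun x => V x a) (hf : ∀ a, Comp q fun x => f x a) (out : ℕ → R.Out)
    (hout : ∀ x, ∀ a < N, g x (f x a) ≠ a → R.Sol x (out a)) (u : TreeNode m N) :
    Solves (4 * q + v) R fun x => BadUp (V x) (f x) (g x) u := by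
  have h₁ : Comp q fun x => out (upQuery₁ N (V x u.1 - 2) u.2) :=
    (hV u.1).map fun k => out (upQuery₁ N (k - 2) u.2)
  have h₂ : Comp (q + q) fun x => out (upQuery₂ N (f x) (V x u.1 - 2) u.2) :=
    (hV u.1).bind (h := fun k x => out (upQuery₂ N (f x) (k - 2) u.2)) fun k =>
      (comp_reblock hf _ _).map fun y => out (offset N (2 * width N (k - 2)) y)
  refine (((Solves.of_comp h₁).or hR (Solves.of_comp h₂)).imp ?_).mono (by omega)
  rintro x ⟨w, hw, hne, rfl | rfl⟩
  · exact .inl (hout x _ hw hne)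
  · exact .inr (hout x _ hw hne)

variable [NeZero N]

theorem comp_treeChild (hS : ∀ v, Comp q fun x => S x v) (hV : ∀ v, Comp q fun x => V x v)
    (hg : ∀ w, Comp q fun x => g x w) (b : ℕ) (u : TreeNode m N) :
    Comp (6 * q) fun x => treeChild (S x) (V x) (g x) b u := by
  have h := (hS u.1).pair (((hV u.1).bind (h := fun k x =>
    layerDown N (g x) (k - 1) (2 * u.2 + b)) fun k => comp_layerDown hg _ _).map
    (Fin.ofNat (2 * N)))
  exact ((comp_inTree hV u).ite h (Comp.const u)).mono (by simp; omega)

theorem comp_treeFather (hP : ∀ v, Comp q fun x => P x v) (hV : ∀ v, Comp q fun x => V x v)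
    (hf : ∀ a, Comp q fun x => f x a) (u : TreeNode m N) :
    Comp (6 * q) fun x => treeFather (P x) (V x) (f x) u := by
  have h := (hP u.1).pair (((hV u.1).bind (h := fun k x =>
    layerUp N (f x) (k - 2) u.2) fun k => comp_layerUp hf _ _).map
    fun z => Fin.ofNat (2 * N) (z / 2))
  exact (((comp_inTree hV u).and ((hV u.1).map fun k => 2 ≤ k)).ite h (Comp.const u)).mono
    (by simp; omega)

end TreeComp

/-! ### The instances of `Lossy-Code ∩ Sink-Of-Metered-Line` -/

/-- The input bits of a pair of a lossy code and a metered line. -/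
abbrev CodeLineVar (N m : ℕ+) : Type :=
  (TableVar N (2 * N : ℕ+) ⊕ TableVar (2 * N : ℕ+) N) ⊕ MeteredLineVar m

namespace CodeLine

variable {N m : ℕ+} (x : CodeLineVar N m → Bool)

/-- The function `f : [N] → [2N]`, on natural numbers. -/
def enc (a : ℕ) : ℕ :=
  (readTable (fun i => x (Sum.inl (Sum.inl i))) (Fin.ofNat N a) : Fin (2 * N : ℕ+))

/-- The function `g : [2N] → [N]`, on natural numbers. -/
def dec (w : ℕ) : ℕ :=
  (readTable (fun i => x (Sum.inl (Sum.inr i))) (Fin.ofNat (2 * N : ℕ+) w) : Fin N)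

/-- The successor function of the line. -/
def succ : Fin m → Fin m := readTable fun i => x (Sum.inr (Sum.inl i))

/-- The predecessor function of the line. -/
def pred : Fin m → Fin m := readTable fun i => x (Sum.inr (Sum.inr (Sum.inl i)))

/-- The meter of the line. -/
def meter (v : Fin m) : ℕ :=
  (readTable (fun i => x (Sum.inr (Sum.inr (Sum.inr i)))) v : Fin (m + 1))

/-- A unit of query depth. -/
def unit (N m : ℕ+) : ℕ := entry (2 * N) + entry (m + 1)

theorem clog_le_unit (N m : ℕ+) : Nat.clog 2 N ≤ unit N m ∧ Nat.clog 2 (2 * N : ℕ+) ≤ unit N m ∧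
    Nat.clog 2 m ≤ unit N m ∧ Nat.clog 2 (m + 1) ≤ unit N m := by
  have h₁ := Nat.clog_mono_right 2 (show (N : ℕ) ≤ 2 * N by omega)
  have h₂ := Nat.clog_mono_right 2 (show (m : ℕ) ≤ m + 1 by omega)
  rw [PNat.mul_coe, PNat.val_ofNat]
  simp only [unit, entry]
  omega

theorem comp_enc (a : ℕ) : Comp (unit N m) fun x : CodeLineVar N m → Bool => enc x a :=
  (Comp.const _).read.val.mono (by have := clog_le_unit N m; omega)

theorem comp_dec (w : ℕ) : Comp (unit N m) fun x : CodeLineVar N m → Bool => dec x w :=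
  (Comp.const _).read.val.mono (by have := clog_le_unit N m; omega)

theorem comp_succ (v : Fin m) : Comp (unit N m) fun x : CodeLineVar N m → Bool => succ x v :=
  (Comp.const _).read.mono (by have := clog_le_unit N m; omega)

theorem comp_pred (v : Fin m) : Comp (unit N m) fun x : CodeLineVar N m → Bool => pred x v :=
  (Comp.const _).read.mono (by have := clog_le_unit N m; omega)

theorem comp_meter (v : Fin m) : Comp (unit N m) fun x : CodeLineVar N m → Bool => meter x v :=
  (Comp.const _).read.val.mono (by have := clog_le_unit N m; omega)

theorem dec_lt (w : ℕ) : dec x w < N := Fin.is_lt _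

theorem enc_lt (a : ℕ) : enc x a < 2 * N := Fin.is_lt _

theorem meter_le (v : Fin m) : meter x v ≤ m := Nat.le_of_lt_succ (Fin.is_lt _)

theorem ofNat_val {n : ℕ} [NeZero n] (a : Fin n) : Fin.ofNat n (a : ℕ) = a :=
  Fin.ext (Nat.mod_eq_of_lt a.2)

/-- `enc` and `dec` reduce their arguments modulo the table length to be total on `ℕ`; in range
nothing wraps around, so a failure is a genuine solution. -/
theorem enc_dec_ne {w : ℕ} (hw : w < 2 * N) (h : enc x (dec x w) ≠ w) :
    (readTable (fun i => x (Sum.inl (Sum.inl i)))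
      (readTable (fun i => x (Sum.inl (Sum.inr i))) (Fin.ofNat (2 * N : ℕ+) w) : Fin N) :
        Fin (2 * N : ℕ+)) ≠ Fin.ofNat (2 * N : ℕ+) w := by
  intro he
  refine h ?_
  unfold enc dec
  rw [ofNat_val, he]
  exact Nat.mod_eq_of_lt hw

theorem dec_enc_ne {a : ℕ} (ha : a < N) (h : dec x (enc x a) ≠ a) :
    (readTable (fun i => x (Sum.inl (Sum.inr i)))
      (readTable (fun i => x (Sum.inl (Sum.inl i))) (Fin.ofNat N a) : Fin (2 * N : ℕ+)) :
        Fin N) ≠ Fin.ofNat N a := by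
  intro he
  refine h ?_
  unfold enc dec
  rw [ofNat_val, he]
  exact Nat.mod_eq_of_lt ha

theorem clog_nodes_le (N m : ℕ+) : Nat.clog 2 (m * (2 * N) : ℕ+) ≤ 2 * unit N m := by
  have h₁ := clog_mul_le m (2 * N)
  have h₂ := clog_le_unit N m
  rw [PNat.mul_coe, PNat.val_ofNat] at h₂
  rw [PNat.mul_coe, PNat.mul_coe, PNat.val_ofNat]
  omega

/-- The father in the tree. -/
noncomputable def father : TreeNode m N → TreeNode m N := treeFather (pred x) (meter x) (enc x)

/-- The children in the tree. -/
noncomputable def child (b : ℕ) : TreeNode m N → TreeNode m N :=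
  treeChild (succ x) (meter x) (dec x) b

theorem comp_father (u : TreeNode m N) :
    Comp (300 * unit N m) fun x : CodeLineVar N m → Bool => father x u :=
  (comp_treeFather comp_pred comp_meter comp_enc u).mono (by omega)

theorem comp_child (b : ℕ) (u : TreeNode m N) :
    Comp (300 * unit N m) fun x : CodeLineVar N m → Bool => child x b u :=
  (comp_treeChild comp_succ comp_meter comp_dec b u).mono (by omega)

theorem comp_height (u : TreeNode m N) :
    Comp (300 * unit N m) fun x : CodeLineVar N m → Bool => meter x u.1 - 1 :=
  Comp.mono (a := unit N m) ((comp_meter u.1).map fun k => k - 1) (by omega)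

theorem height_lt (u : TreeNode m N) : meter x u.1 - 1 < (m * (2 * N) : ℕ+) := by
  have h₁ := meter_le x u.1
  have h₂ : (m : ℕ) ≤ m * (2 * N) := Nat.le_mul_of_pos_right _ (by have := N.pos; omega)
  have h₃ := m.pos
  rw [PNat.mul_coe, PNat.mul_coe, PNat.val_ofNat]
  omega

end CodeLine

open CodeLine

theorem lossyCode_inter_sinkOfMeteredLine_reduces :
    LossyCode.inter SinkOfMeteredLine ≤dt EmptyChildHeight := by
  refine reduces_iff.2 ⟨10000, 1, fun ⟨(N : ℕ+), (m : ℕ+)⟩ =>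
    ⟨m * (2 * N), 300 * unit N m, ?_, ?_⟩⟩
  · have hv := ((verifiable_lossyCode N).inter (verifiable_sinkOfMeteredLine m)).mono
      (show _ ≤ 42 * unit N m by unfold unit; omega)
    refine red_emptyChildHeight (m * (2 * N)) (by simp) ((0, 0) : TreeNode m N)
      father (child · 0) (child · 1) (fun x u => meter x u.1 - 1) height_lt comp_father
      (comp_child 0) (comp_child 1) comp_height (fun u => ?_)
    have h := (Solves.of_out (R := (LossyCode.inter SinkOfMeteredLine).prob (N, m))
      (Sum.inr u.1)).or hv (Solves.badDown hv (comp_meter (N := N) (m := m)) comp_dec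
        (fun w => Sum.inl (Fin.ofNat (2 * N : ℕ+) w)) (fun x w => enc_dec_ne x) u)
    refine (h.imp fun x hx => ?_).mono (by omega)
    exact tree_solution (S := succ x) (P := pred x) (V := meter x) (f := enc x) (dec_lt x) hx
  · have h₁ := log_size_emptyChildHeight (m * (2 * N))
    have h₂ := clog_nodes_le N m
    have h₃ := entry_lossyCode N
    have h₄ := entry_sinkOfMeteredLine m
    have h₅ := log_size_le_inter_left LossyCode SinkOfMeteredLine (N, m)
    have h₆ := log_size_le_inter_right LossyCode SinkOfMeteredLine (N, m)
    dsimp only at h₅ h₆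
    rw [pow_one]
    unfold unit at *
    omega

theorem bijLossyCode_inter_endOfMeteredLine_reduces :
    BijLossyCode.inter EndOfMeteredLine ≤dt BinaryEmptyChildHeight := by
  refine reduces_iff.2 ⟨10000, 1, fun ⟨(N : ℕ+), (m : ℕ+)⟩ =>
    ⟨m * (2 * N), 400 * unit N m, ?_, ?_⟩⟩
  · have hv := ((verifiable_bijLossyCode N).inter (verifiable_endOfMeteredLine m)).mono
      (show _ ≤ 42 * unit N m by unfold unit; omega)
    refine red_binaryEmptyChildHeight (m * (2 * N)) (by simp) ((0, 0) : TreeNode m N)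
      father (child · 0) (child · 1) (fun x u => meter x u.1 - 1) height_lt
      (fun u => (comp_father u).mono (by omega)) (fun u => (comp_child 0 u).mono (by omega))
      (fun u => (comp_child 1 u).mono (by omega)) (fun u => (comp_height u).mono (by omega))
      (fun u => ?_)
    have h := (Solves.of_out (R := (BijLossyCode.inter EndOfMeteredLine).prob (N, m))
      (Sum.inr u.1)).or hv ((Solves.badUp hv (comp_meter (N := N) (m := m)) comp_enc
        (fun a => Sum.inl (Sum.inr (Fin.ofNat N a))) (fun x a => dec_enc_ne x) u).or hv
      (Solves.badDown hv (comp_meter (N := N) (m := m)) comp_dec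
        (fun w => Sum.inl (Sum.inl (Fin.ofNat (2 * N : ℕ+) w))) (fun x w => enc_dec_ne x) u))
    refine (h.imp fun x hx => ?_).mono (by omega)
    -- Only the wrong-father clause needs the additional solutions of the bijective code and of the
    -- two-sided line.
    rcases hx with hx | hx | ⟨h₀, hL, hR⟩ | hx
    · exact (tree_solution (dec_lt x) (.inl hx)).imp Or.inl Or.inr
    · exact (tree_solution (dec_lt x) (.inr (.inl hx))).imp Or.inl Or.inr
    · exact (tree_wrongFather (enc_lt x) h₀ hL hR).imp id Or.inl
    · exact (tree_solution (dec_lt x) (.inr (.inr hx))).imp Or.inl Or.inr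
  · have h₁ := log_size_binaryEmptyChildHeight (m * (2 * N))
    have h₂ := clog_nodes_le N m
    have h₃ := entry_bijLossyCode N
    have h₄ := entry_endOfMeteredLine m
    have h₅ := log_size_le_inter_left BijLossyCode EndOfMeteredLine (N, m)
    have h₆ := log_size_le_inter_right BijLossyCode EndOfMeteredLine (N, m)
    dsimp only at h₅ h₆
    rw [pow_one]
    unfold unit at *
    omega

end BlackBox

/-! ### Assembly of the reductions -/

theorem mainTheorem8 :
    EmptyChildHeight ∈ TFNPdt ∧
    IsCompleteFor EmptyChildHeight (SOPL ∩ Lossy) ∧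
    LossyCode.inter SinkOfMeteredLine ≤dt EmptyChildHeight ∧
    EmptyChildHeight ∈ PLS ∧
    EmptyChildHeight ∈ Lossy ∧
    EmptyChildHeight ∈ SOPL ∧
    SOPL = PLS ∩ PPADS ∧
    BijLossyCode.inter EndOfMeteredLine ≤dt BinaryEmptyChildHeight := by
  have hSOPL : EmptyChildHeight ∈ SOPL :=
    ⟨isTotal_emptyChildHeight, emptyChildHeight_reduces_sinkOfPotentialLine⟩
  have hLossy : EmptyChildHeight ∈ Lossy :=
    ⟨isTotal_emptyChildHeight, emptyChildHeight_reduces_lossyCode⟩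
  have hPLS : EmptyChildHeight ∈ PLS := by
    rw [SOPL_eq_PLS_inter_PPADS] at hSOPL
    exact hSOPL.1
  refine ⟨emptyChildHeight_mem_TFNPdt, ⟨⟨hSOPL, hLossy⟩, ?_⟩,
    lossyCode_inter_sinkOfMeteredLine_reduces, hPLS, hLossy, hSOPL, SOPL_eq_PLS_inter_PPADS,
    bijLossyCode_inter_endOfMeteredLine_reduces⟩
  rintro Q ⟨⟨-, h₁⟩, -, h₂⟩
  -- The potential line must first become metered, because the layers of the tree are indexed by the
  -- meter.
  exact (h₂.inter (h₁.trans sinkOfPotentialLine_reduces_sinkOfMeteredLine)).trans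
    lossyCode_inter_sinkOfMeteredLine_reduces
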